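/- **Setting.** Let $\mathbb K$ be $\mathbb R$ or $\mathbb C$ and $M$ a smooth manifold. Let $L\to M$ be a Lie algebroid over $\mathbb K$: a $\mathbb K$-vector bundle of finite rank with an anchor $\rho\colon L\to TM\otimes_{\mathbb R}\mathbb K$ and a $\mathbb K$-Lie bracket $[\cdot,\cdot]_L$ on $\Gamma(L)$ such that $\rho$ is a morphism of Lie algebras on sections and $[u,fv]_L=(\rho(u)f)v+f[u,v]_L$ for $f\in C^\infty(M,\mathbb K)$. Let $A\subset L$ be a Lie subalgebroid and $B\subset L$ a subbundle with $L=A\oplus B$, with projections $\mathrm{pr}_A,\mathrm{pr}_B$. For $a\in\Gamma(A)$ and $b,b'\in\Gamma(B)$ put $\nabla_ab=\mathrm{pr}_B[a,b]_L$, $\eth_ba=\mathrm{pr}_A[b,a]_L$, $[b,b']_B=\mathrm{pr}_B[b,b']_L$, $\beta(b,b')=\mathrm{pr}_A[b,b']_L$. *Brackets.* Let $\Omega^k=\Omega^k_A(B)=\Gamma(\Lambda^kA^\vee\otimes B)$ and $\Omega^\bullet_A(B)=\bigoplus_k\Omega^k$. For $X\in\Omega^p$, $Y\in\Omega^q$,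 $Z\in\Omega^r$ and $a_i\in\Gamma(A)$, let $$(dX)(a_1,\dots,a_{p+1})=\sum_i(-1)^{i+1}\nabla_{a_i}\big(X(\dots,\hat a_i,\dots)\big)+\sum_{i<j}(-1)^{i+j}X([a_i,a_j]_L,\dots,\hat a_i,\dots,\hat a_j,\dots),$$ $$[X,Y]_2(a_1,\dots,a_{p+q})=\sum_{\sigma\in\mathrm{Sh}(p,q)}\mathrm{sgn}(\sigma)\Big(\sum_{i=1}^pX(a_{\sigma(1)},\dots,\eth_{Y(a_{\sigma(p+1)},\dots)}a_{\sigma(i)},\dots,a_{\sigma(p)})-\sum_{j=1}^qY(a_{\sigma(p+1)},\dots,\eth_{X(a_{\sigma(1)},\dots)}a_{\sigma(p+j)},\dots,a_{\sigma(p+q)})+[X(a_{\sigma(1)},\dots),Y(a_{\sigma(p+1)},\dots)]_B\Big),$$ $$\begin{aligned}[X,Y,Z]_3(a_1,\dots,a_{p+q+r-1})&=(-1)^{p+q+1}\sum_{\sigma\in\mathrm{Sh}(p,q,r-1)}\mathrm{sgn}(\sigma)\,Z\big(\beta(X(a_{\sigma(1)},\dots),Y(a_{\sigma(p+1)},\dots)),a_{\sigma(p+q+1)},\dots\big)\\&\quad+(-1)^p\sum_{\sigma\in\mathrm{Sh}(p,q-1,r)}\mathrm{sgn}(\sigma)\,Y\big(\beta(X(a_{\sigma(1)},\dots),Z(a_{\sigma(p+q)},\dots)),a_{\sigma(p+1)},\dots\big)\\&\quad-\sum_{\sigma\in\mathrm{Sh}(p-1,q,r)}\mathrm{sgn}(\sigma)\,X\big(\beta(Y(a_{\sigma(p)},\dots),Z(a_{\sigma(p+q)},\dots)),a_{\sigma(1)},\dots\big),\end{aligned}$$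 where the first, second, third sum is $0$ if $r=0$, $q=0$, $p=0$ respectively. Put $[X]_1=dX$ and $[\cdots]_k=0$ for $k\ge4$. *Derivations and their action.* $\mathrm{Der}(L)$ is the space of $\mathbb K$-linear operators $\delta$ on $\Gamma(L)$ for which there is a vector field $s\in\mathfrak X(M)\otimes\mathbb K$ with $\delta(fu)=s(f)u+f\delta(u)$, $[s,\rho(u)]=\rho(\delta(u))$ and $\delta[u,v]_L=[\delta u,v]_L+[u,\delta v]_L$ for all $u,v\in\Gamma(L)$, $f\in C^\infty(M,\mathbb K)$. For $\delta\in\mathrm{Der}(L)$, $X\in\Omega^p$, $Y\in\Omega^q$ let $\kappa(\delta)\in\Omega^1$, $\delta\triangleright X\in\Omega^p$ and $\delta\triangleright(X,Y)\in\Omega^{p+q-1}$ be given by $$\kappa(\delta)(a)=-\mathrm{pr}_B\delta(a),\qquad(\delta\triangleright X)(a_1,\dots,a_p)=\mathrm{pr}_B\delta(X(a_1,\dots,a_p))-\sum_jX(a_1,\dots,\mathrm{pr}_A\delta(a_j),\dots,a_p),$$ $$\begin{aligned}(\delta\triangleright(X,Y))(a_1,\dots,a_{p+q-1})&=(-1)^{p+1}\sum_{\sigma\in\mathrm{Sh}(p,q-1)}\mathrm{sgn}(\sigma)\,Y\big(\mathrm{pr}_A\delta(X(a_{\sigma(1)},\dots)),a_{\sigma(p+1)},\dots\big)\\&\quad+\sum_{\sigma\in\mathrm{Sh}(p-1,q)}\mathrm{sgn}(\sigma)\,X\big(\mathrm{pr}_A\delta(Y(a_{\sigma(p)},\dots)),a_{\sigma(1)},\dots\big),\end{aligned}$$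 where the first (second) sum is $0$ if $q=0$ ($p=0$). Write $\delta\triangleright()=\kappa(\delta)$, and let $\delta\triangleright(X_1,\dots,X_k)=0$ for $k\ge3$. *Coefficients and gauge actions.* Let $\mathscr A$ be a commutative local Artinian $\mathbb K$-algebra with residue field $\mathbb K$ and maximal ideal $\mathfrak m$. All the maps above are extended $\mathscr A$-multilinearly to coefficients in $\mathfrak m$ (tensor products over $\mathbb K$). $\mathrm{MC}$ is the set of $\xi\in\Omega^1\otimes\mathfrak m$ with $\sum_{k\ge1}\frac1{k!}[\xi,\dots,\xi]_k=0$. For $\xi\in\mathrm{MC}$ let $[g_1,\dots,g_i]^\xi=\sum_{k\ge0}\frac1{k!}[\xi,\dots,\xi,g_1,\dots,g_i]_{i+k}$ with $k$ entries $\xi$. For $b\in\Gamma(B)\otimes\mathfrak m$ define $e^b*\xi=\xi-\sum_{k\ge1}\frac1{k!}e^k_\xi(b)$ with $e^1_\xi(b)=[b]^\xi$ and $$e^{k+1}_\xi(b)=\sum_{n=1}^k\frac1{n!}\sum_{\substack{k_1+\dots+k_n=k\\k_i\ge1}}\frac{k!}{k_1!\cdots k_n!}\,[b,e^{k_1}_\xi(b),\dots,e^{k_n}_\xi(b)]^\xi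 .$$ For $\delta\in\mathrm{Der}(L)\otimes\mathfrak m$ define $e^\delta*\xi=\xi-\sum_{k\ge1}\frac1{k!}e^k_\xi(\delta)$ with $e^1_\xi(\delta)=\sum_{j\ge0}\frac{(-1)^j}{j!}\delta\triangleright(\xi,\dots,\xi)$ ($j$ entries $\xi$) and $$e^{k+1}_\xi(\delta)=\sum_{n=1}^k\frac1{n!}\sum_{\substack{k_1+\dots+k_n=k\\k_i\ge1}}\frac{k!}{k_1!\cdots k_n!}\sum_{j\ge0}\frac{(-1)^j}{j!}\,\delta\triangleright(\underbrace{\xi,\dots,\xi}_j,e^{k_1}_\xi(\delta),\dots,e^{k_n}_\xi(\delta)).$$ **Theorem.** Let $b\in\Gamma(B)\otimes\mathfrak m$. 1. The operator $\mathrm{ad}_b=[b,\cdot]_L\colon\Gamma(L)\otimes\mathscr A\to\Gamma(L)\otimes\mathfrak m$ is a derivation: there is a unique element of $\mathrm{Der}(L)\otimes\mathfrak m$, again denoted by $\mathrm{ad}_b$, that induces it. 2. For all $X,Y\in\Omega^\bullet_A(B)\otimes\mathfrak m$, $$\kappa(\mathrm{ad}_b)=d\,b,\qquad\mathrm{ad}_b\triangleright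 X=[b,X]_2,\qquad\mathrm{ad}_b\triangleright(X,Y)=[b,X,Y]_3 .$$ 3. For every $\xi\in\mathrm{MC}$, only finitely many of the $e^k_\xi(\mathrm{ad}_b)$ and of the $e^k_\xi(b)$ are nonzero, and $e^{\mathrm{ad}_b}*\xi=e^b*\xi$. -/

import Mathlib

open scoped TensorProduct DirectSum
open scoped Manifold ContDiff Bundle
open Nat (factorial)

/-! # Lie–Rinehart structures

All the constructions below are made for a module `L` over a commutative algebra `R`: the sections
of a vector bundle, over the smooth functions. -/

/-- A Lie–Rinehart structure on the `R`-module `L` over the field `K`: a `K`-bilinear Lie bracket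
on `L` and an `R`-linear anchor `L → Der_K(R)` which is a morphism of Lie algebras, with the
Leibniz rule `[u, f v] = ρ(u)(f) v + f [u, v]`. The bracket is a datum and not a type class, since
the module of sections has no distinguished Lie bracket. -/
structure LieRinehart (K R L : Type*) [Field K] [CommRing R] [Algebra K R]
    [AddCommGroup L] [Module K L] [Module R L] where
  bracket : L →ₗ[K] L →ₗ[K] L
  anchor : L →ₗ[R] Derivation K R R
  bracket_self : ∀ u, bracket u u = 0
  jacobi : ∀ u v w,
    bracket u (bracket v w) = bracket (bracket u v) w + bracket v (bracket u w)
  anchor_bracket : ∀ u v, anchor (bracket u v) = ⁅anchor u, anchor v⁆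
  leibniz : ∀ (u v : L) (f : R), bracket u (f • v) = anchor u f • v + f • bracket u v

namespace LieRinehart

variable {K R L : Type*} [Field K] [CommRing R] [Algebra K R]
    [AddCommGroup L] [Module K L] [Module R L]

theorem bracket_skew (P : LieRinehart K R L) (u v : L) : P.bracket u v = - P.bracket v u := by
  have h := P.bracket_self (u + v)
  simp only [map_add, LinearMap.add_apply, P.bracket_self, zero_add, add_zero] at h
  exact eq_neg_of_add_eq_zero_right h

theorem bracket_smul_left (P : LieRinehart K R L) (f : R) (u v : L) :
    P.bracket (f • u) v = f • P.bracket u v - P.anchor v f • u := by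
  rw [P.bracket_skew, P.leibniz, P.bracket_skew v u]; simp [sub_eq_add_neg, add_comm]

/-- The derivations of `L`: the `K`-linear operators `δ` on `L` for which there is a derivation
`s` of `R` (the symbol of `δ`) such that `δ(f u) = s(f) u + f δ(u)`, `[s, ρ(u)] = ρ(δ(u))` and
`δ[u, v] = [δ(u), v] + [u, δ(v)]`. -/
def der [IsScalarTower K R L] (P : LieRinehart K R L) : Submodule K (L →ₗ[K] L) where
  carrier := {δ | ∃ s : Derivation K R R,
    (∀ (f : R) (u : L), δ (f • u) = s f • u + f • δ u) ∧
    (∀ u : L, ⁅s, P.anchor u⁆ = P.anchor (δ u)) ∧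
    ∀ u v : L, δ (P.bracket u v) = P.bracket (δ u) v + P.bracket u (δ v)}
  zero_mem' := ⟨0, by simp, by simp, by simp⟩
  add_mem' := by
    rintro δ δ' ⟨s, h1, h2, h3⟩ ⟨s', h1', h2', h3'⟩
    refine ⟨s + s', fun f u => ?_, fun u => ?_, fun u v => ?_⟩
    · simp only [LinearMap.add_apply, h1, h1', Derivation.add_apply, add_smul, smul_add]; abel
    · simp [add_lie, h2, h2']
    · simp only [LinearMap.add_apply, h3, h3', map_add]; abel
  smul_mem' := by
    rintro c δ ⟨s, h1, h2, h3⟩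
    refine ⟨c • s, fun f u => ?_, fun u => ?_, fun u v => ?_⟩
    · simp [h1, smul_add, smul_comm c f]
    · rw [smul_lie, h2, LinearMap.smul_apply, ← algebraMap_smul R c (δ u),
        ← algebraMap_smul R c (P.anchor _), map_smul]
    · simp [h3]

end LieRinehart

/-- A Lie–Rinehart algebra `L` with a subalgebra `A` and a complement `B` of `A` (an `R`-submodule,
in general not a subalgebra): `L = A ⊕ B`. -/
structure SplitLiePair (K R L : Type*) [Field K] [CommRing R] [Algebra K R]
    [AddCommGroup L] [Module K L] [Module R L] extends LieRinehart K R L where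
  A : Submodule R L
  B : Submodule R L
  isCompl : IsCompl A B
  bracket_mem : ∀ u ∈ A, ∀ v ∈ A, bracket u v ∈ A

namespace SplitLiePair

section Forms

variable {S : Type*} [CommRing S] {V W : Type*} [AddCommGroup V] [Module S V]
  [AddCommGroup W] [Module S W]

/-- `(slotSum φ X)(v₁,…,vₖ) = ∑ⱼ X(v₁,…,φ(vⱼ),…,vₖ)`. -/
def slotSum {k : ℕ} (φ : V →ₗ[S] V) (X : V [⋀^Fin k]→ₗ[S] W) : V [⋀^Fin k]→ₗ[S] W where
  toFun v := ∑ j, X (Function.update v j (φ (v j)))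
  map_update_add' := by
    intro inst v i x y
    obtain rfl : inst = instDecidableEqFin k := Subsingleton.elim _ _
    rw [← Finset.sum_add_distrib]
    refine Finset.sum_congr rfl fun j _ => ?_
    by_cases h : j = i
    · subst h; simp [X.map_update_add]
    · simp only [Function.update_of_ne h, Function.update_comm (Ne.symm h)]
      exact X.map_update_add _ _ _ _
  map_update_smul' := by
    intro inst v i c x
    obtain rfl : inst = instDecidableEqFin k := Subsingleton.elim _ _
    rw [Finset.smul_sum]
    refine Finset.sum_congr rfl fun j _ => ?_
    by_cases h : j = i
    · subst h; simp [X.map_update_smul]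
    · simp only [Function.update_of_ne h, Function.update_comm (Ne.symm h)]
      exact X.map_update_smul _ _ _ _
  map_eq_zero_of_eq' := by
    intro v i j hv hij
    have key : X (Function.update v i (φ (v i))) + X (Function.update v j (φ (v j))) = 0 := by
      have h := X.map_swap (Function.update v i (φ (v i))) hij
      have h2 : Function.update v i (φ (v i)) ∘ Equiv.swap i j
          = Function.update v j (φ (v j)) := by
        funext l
        simp only [Function.comp_apply]
        rcases eq_or_ne l i with rfl | hi
        · simp [hij, hij.symm, hv]
        rcases eq_or_ne l j with rfl | hj
        · simp [hv]
        · simp [Equiv.swap_apply_of_ne_of_ne hi hj, hi, hj]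
      rw [h2] at h
      rw [h, add_neg_cancel]
    rw [← key]
    refine Fintype.sum_eq_add _ _ hij fun l ⟨hi, hj⟩ => ?_
    exact X.map_eq_zero_of_eq _ (by simp [Function.update_of_ne hi.symm,
      Function.update_of_ne hj.symm, hv]) hij

end Forms

variable {K R L : Type*} [Field K] [CommRing R] [Algebra K R]
    [AddCommGroup L] [Module K L] [Module R L] [IsScalarTower K R L]

/-- An alternating `R`-multilinear map, regarded as an alternating `K`-multilinear map. -/
def restrictK {V W : Submodule R L} {k : ℕ} (X : V [⋀^Fin k]→ₗ[R] W) : V [⋀^Fin k]→ₗ[K] W :=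
  { X.toMultilinearMap.restrictScalars K with
    map_eq_zero_of_eq' := X.map_eq_zero_of_eq' }

/-- An alternating `K`-multilinear map which is homogeneous over `R` in every slot, regarded as an
alternating `R`-multilinear map. -/
def extendR {V W : Submodule R L} {k : ℕ} (X : V [⋀^Fin k]→ₗ[K] W)
    (h : ∀ (v : Fin k → V) (i : Fin k) (f : R) (x : V),
      X (Function.update v i (f • x)) = f • X (Function.update v i x)) :
    V [⋀^Fin k]→ₗ[R] W where
  toFun := X
  map_update_add' := by
    intro inst v i x y
    obtain rfl : inst = instDecidableEqFin k := Subsingleton.elim _ _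
    rw [X.map_update_add]
  map_update_smul' := by
    intro inst v i c x
    obtain rfl : inst = instDecidableEqFin k := Subsingleton.elim _ _
    rw [h]
  map_eq_zero_of_eq' := X.map_eq_zero_of_eq'

@[simp] theorem restrictK_apply {V W : Submodule R L} {k : ℕ} (X : V [⋀^Fin k]→ₗ[R] W)
    (v : Fin k → V) : restrictK (K := K) X v = X v := rfl

@[simp] theorem extendR_apply {V W : Submodule R L} {k : ℕ} (X : V [⋀^Fin k]→ₗ[K] W)
    (h) (v : Fin k → V) : extendR (R := R) X h v = X v := rfl

theorem slotSum_apply {S : Type*} [CommRing S] {V W : Type*} [AddCommGroup V] [Module S V]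
    [AddCommGroup W] [Module S W] {k : ℕ} (φ : V →ₗ[S] V) (X : V [⋀^Fin k]→ₗ[S] W)
    (v : Fin k → V) : slotSum φ X v = ∑ j, X (Function.update v j (φ (v j))) := rfl

/-- If `φ(f x) = f φ(x) + s(f) x` then the analogous rule holds for `slotSum φ`. -/
theorem slotSum_smul {V W : Submodule R L} {k : ℕ} (X : V [⋀^Fin k]→ₗ[R] W)
    (φ : V →ₗ[K] V) (s : R → R) (hφ : ∀ (f : R) (x : V), φ (f • x) = s f • x + f • φ x)
    (v : Fin k → V) (i : Fin k) (f : R) (x : V) :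
    slotSum φ (restrictK X) (Function.update v i (f • x)) =
      s f • X (Function.update v i x) + f • slotSum φ (restrictK X) (Function.update v i x) := by
  have h : ∀ j, X (Function.update (Function.update v i (f • x)) j
        (φ (Function.update v i (f • x) j))) =
      (if j = i then s f • X (Function.update v i x) else 0) +
        f • X (Function.update (Function.update v i x) j (φ (Function.update v i x j))) := by
    intro j
    by_cases h : j = i
    · subst h
      simp [hφ, X.map_update_add, X.map_update_smul]
    · simp only [Function.update_of_ne h, Function.update_comm (Ne.symm h), X.map_update_smul,
        if_neg h, zero_add]
  simp only [slotSum_apply, restrictK_apply, h, Finset.sum_add_distrib, Finset.smul_sum]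
  simp

section antisymmetrize

variable (K)

/-- The alternating map `c • ∑_σ sgn(σ) (H ∘ σ)`, summed over all permutations `σ` of the `n`
arguments. The arguments of `H` are indexed by `ι`, and `e : ι ≃ Fin n` is their order.

If `ι` consists of two consecutive blocks of sizes `p` and `q`, if `H` is alternating in each block
and `c = 1 / (p! q!)`, this is the sum of `sgn(σ) (H ∘ σ)` over the `(p, q)`-shuffles `σ`; likewise
for three blocks. This is how the sums over shuffles are written below. -/
noncomputable def antisymmetrize {V W : Submodule R L} {ι : Type*} [Fintype ι] {n : ℕ} (c : K)
    (e : ι ≃ Fin n) (H : MultilinearMap R (fun _ : ι => V) W) : V [⋀^Fin n]→ₗ[R] W :=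
  c • MultilinearMap.alternatization (H.domDomCongr e)

theorem antisymm_add {V W : Submodule R L} {ι : Type*} [Fintype ι] {n : ℕ} (c : K)
    (e : ι ≃ Fin n) (H H' : MultilinearMap R (fun _ : ι => V) W) :
    antisymmetrize K c e (H + H') = antisymmetrize K c e H + antisymmetrize K c e H' := by
  have : (H + H').domDomCongr e = H.domDomCongr e + H'.domDomCongr e := rfl
  rw [antisymmetrize, this, map_add, smul_add]; rfl

theorem antisymm_smul {V W : Submodule R L} {ι : Type*} [Fintype ι] {n : ℕ} (c : K)
    (e : ι ≃ Fin n) (a : K) (H : MultilinearMap R (fun _ : ι => V) W) :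
    antisymmetrize K c e (a • H) = a • antisymmetrize K c e H := by
  ext v
  simp only [antisymmetrize, AlternatingMap.smul_apply, MultilinearMap.alternatization_apply,
    MultilinearMap.domDomCongr_apply, smul_apply]
  rw [smul_comm a c]
  congr 2
  rw [Finset.smul_sum]
  refine Finset.sum_congr rfl fun σ _ => ?_
  rw [smul_comm]

end antisymmetrize

variable (P : SplitLiePair K R L)

/-- The projection `L → A` along `B`. -/
noncomputable def prA : L →ₗ[R] P.A := P.A.projectionOnto P.B P.isCompl

/-- The projection `L → B` along `A`. -/
noncomputable def prB : L →ₗ[R] P.B := P.B.projectionOnto P.A P.isCompl.symm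

@[simp] theorem prA_A (a : P.A) : P.prA a = a := by simp [prA]
@[simp] theorem prB_B (b : P.B) : P.prB b = b := by simp [prB]
@[simp] theorem prA_B (b : P.B) : P.prA b = 0 := by simp [prA]
@[simp] theorem prB_A (a : P.A) : P.prB a = 0 := by simp [prB]

/-- The Bott connection `∇_a b = pr_B [a,b]`. -/
noncomputable def nabla : P.A →ₗ[K] P.B →ₗ[K] P.B :=
  (P.bracket.compr₂ (P.prB.restrictScalars K)).compl₁₂
    (P.A.subtype.restrictScalars K) (P.B.subtype.restrictScalars K)

/-- The operation `ð_b a = pr_A [b,a]`. -/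
noncomputable def eth : P.B →ₗ[K] P.A →ₗ[K] P.A :=
  (P.bracket.compr₂ (P.prA.restrictScalars K)).compl₁₂
    (P.B.subtype.restrictScalars K) (P.A.subtype.restrictScalars K)

/-- The bracket `[a,a']_A` of `A`. -/
noncomputable def brA : P.A →ₗ[K] P.A →ₗ[K] P.A :=
  (P.bracket.compr₂ (P.prA.restrictScalars K)).compl₁₂
    (P.A.subtype.restrictScalars K) (P.A.subtype.restrictScalars K)

/-- The operation `[b,b']_B = pr_B [b,b']`. -/
noncomputable def brB : P.B →ₗ[K] P.B →ₗ[K] P.B :=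
  (P.bracket.compr₂ (P.prB.restrictScalars K)).compl₁₂
    (P.B.subtype.restrictScalars K) (P.B.subtype.restrictScalars K)

theorem nabla_apply (a : P.A) (b : P.B) : P.nabla a b = P.prB (P.bracket a b) := rfl
theorem eth_apply (b : P.B) (a : P.A) : P.eth b a = P.prA (P.bracket b a) := rfl
theorem brA_apply (a a' : P.A) : P.brA a a' = P.prA (P.bracket a a') := rfl
theorem brB_apply (b b' : P.B) : P.brB b b' = P.prB (P.bracket b b') := rfl

theorem coe_brA (a a' : P.A) : (P.brA a a' : L) = P.bracket a a' := by
  have h := P.prA_A ⟨P.bracket a a', P.bracket_mem _ a.2 _ a'.2⟩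
  exact congrArg Subtype.val h

/-- The `R`-bilinear map `β(b,b') = pr_A [b,b']`. -/
noncomputable def beta : P.B →ₗ[R] P.B →ₗ[R] P.A :=
  LinearMap.mk₂ R (fun b b' => P.prA (P.bracket b b')) (by simp) (by
      intro f b b'
      rw [Submodule.coe_smul, P.bracket_smul_left]; simp) (by simp) (by
      intro f b b'
      rw [Submodule.coe_smul, P.leibniz]; simp)

theorem nabla_smul_left (f : R) (a : P.A) (b : P.B) : P.nabla (f • a) b = f • P.nabla a b := by
  simp [nabla_apply, P.bracket_smul_left]

theorem nabla_smul_right (f : R) (a : P.A) (b : P.B) :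
    P.nabla a (f • b) = P.anchor a f • b + f • P.nabla a b := by
  simp [nabla_apply, P.leibniz]

theorem eth_smul_left (f : R) (b : P.B) (a : P.A) : P.eth (f • b) a = f • P.eth b a := by
  simp [eth_apply, P.bracket_smul_left]

theorem eth_smul_right (f : R) (b : P.B) (a : P.A) :
    P.eth b (f • a) = P.anchor b f • a + f • P.eth b a := by
  simp [eth_apply, P.leibniz]

theorem brA_smul_right (f : R) (a a' : P.A) :
    P.brA a (f • a') = P.anchor a f • a' + f • P.brA a a' := by
  simp [brA_apply, P.leibniz]

theorem brA_smul_left (f : R) (a a' : P.A) :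
    P.brA (f • a) a' = f • P.brA a a' - P.anchor a' f • a := by
  simp [brA_apply, P.bracket_smul_left]

theorem brB_smul_right (f : R) (b b' : P.B) :
    P.brB b (f • b') = P.anchor b f • b' + f • P.brB b b' := by
  simp [brB_apply, P.leibniz]

theorem brB_smul_left (f : R) (b b' : P.B) :
    P.brB (f • b) b' = f • P.brB b b' - P.anchor b' f • b := by
  simp [brB_apply, P.bracket_smul_left]

/-- The `B`-valued `A`-forms of degree `k`: alternating `R`-multilinear maps `A^k → B`. -/
abbrev Form (k : ℕ) : Type _ := P.A [⋀^Fin k]→ₗ[R] P.B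

/-- The graded space `Ω_A(B)` of `B`-valued `A`-forms. -/
abbrev Forms : Type _ := ⨁ k, P.Form k

section Unary

variable [CharZero K]

/-- The alternating map `(v₁,…,vₖ) ↦ ∇_a (X(v₁,…,vₖ)) - ½ ∑ⱼ X(v₁,…,[a,vⱼ],…,vₖ)`, for `a ∈ A`. -/
noncomputable def preBott {k : ℕ} (X : P.Form k) : P.A →ₗ[K] P.A [⋀^Fin k]→ₗ[K] P.B where
  toFun a := (P.nabla a).compAlternatingMap (restrictK X)
    - (2 : K)⁻¹ • slotSum (P.brA a) (restrictK X)
  map_add' a a' := by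
    ext v
    simp only [map_add, AlternatingMap.sub_apply, AlternatingMap.add_apply,
      LinearMap.compAlternatingMap_apply, AlternatingMap.smul_apply, slotSum_apply,
      LinearMap.add_apply, restrictK_apply, X.map_update_add, Finset.sum_add_distrib, smul_add]
    abel_nf
  map_smul' c a := by
    ext v
    have h : ∀ j y, X (Function.update v j (c • y)) = c • X (Function.update v j y) := by
      intro j y
      exact (restrictK (K := K) X).map_update_smul v j c y
    simp only [map_smul, AlternatingMap.sub_apply, RingHom.id_apply,
      LinearMap.compAlternatingMap_apply, AlternatingMap.smul_apply, slotSum_apply,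
      LinearMap.smul_apply, restrictK_apply, h, ← Finset.smul_sum, smul_sub]
    rw [smul_comm c]

theorem preBott_apply {k : ℕ} (X : P.Form k) (a : P.A) (v : Fin k → P.A) :
    P.preBott X a v = P.nabla a (X v)
      - (2 : K)⁻¹ • ∑ j, X (Function.update v j (P.brA a (v j))) := rfl

theorem preBott_smul_left {k : ℕ} (X : P.Form k) (f : R) (a : P.A) (v : Fin k → P.A) :
    P.preBott X (f • a) v = f • P.preBott X a v
      + (2 : K)⁻¹ • ∑ j, P.anchor (v j) f • X (Function.update v j a) := by
  simp only [preBott_apply, nabla_smul_left, brA_smul_left, X.map_update_sub,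
    X.map_update_smul, Finset.sum_sub_distrib, smul_sub, Finset.smul_sum]
  simp only [smul_comm f (2 : K)⁻¹]
  abel

theorem preBott_smul_slot {k : ℕ} (X : P.Form k) (f : R) (a x : P.A) (v : Fin k → P.A)
    (i : Fin k) :
    P.preBott X a (Function.update v i (f • x)) = f • P.preBott X a (Function.update v i x)
      + (2 : K)⁻¹ • P.anchor a f • X (Function.update v i x) := by
  have h := slotSum_smul X (P.brA a) (P.anchor (a : L)) (fun f x => P.brA_smul_right f a x) v i f x
  have h2 : ∀ w, P.preBott X a w = P.nabla a (X w)
    - (2 : K)⁻¹ • slotSum (P.brA a) (restrictK X) w := fun _ => rfl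
  rw [h2, h2, h, X.map_update_smul, nabla_smul_right, smul_add, smul_sub,
    smul_comm f (2 : K)⁻¹]
  set y := P.anchor (a : L) f • X (Function.update v i x) with hy
  have h3 : y = (2 : K)⁻¹ • y + (2 : K)⁻¹ • y := by
    rw [← add_smul]
    have : (2 : K)⁻¹ + (2 : K)⁻¹ = 1 := by
      rw [← two_mul]; exact mul_inv_cancel₀ two_ne_zero
    rw [this, one_smul]
  nth_rewrite 1 [h3]
  abel

/-- The Chevalley–Eilenberg differential of `X` as a `K`-multilinear map:
`∑ᵢ (-1)ⁱ (∇_{vᵢ} (X(…,v̂ᵢ,…)) - ½ ∑_{j≠i} X(…,v̂ᵢ,…,[vᵢ,vⱼ],…))`, with `i = 0,…,k`.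
The second part is `∑_{i<j} (-1)^(i+j) X([vᵢ,vⱼ],…,v̂ᵢ,…,v̂ⱼ,…)`, in which each unordered pair
occurs once (in the double sum it occurs twice, whence the factor `½`). -/
noncomputable def bottK {k : ℕ} (X : P.Form k) : P.A [⋀^Fin (k + 1)]→ₗ[K] P.B :=
  AlternatingMap.alternatizeUncurryFin (P.preBott X)

theorem bottK_apply {k : ℕ} (X : P.Form k) (v : Fin (k + 1) → P.A) :
    P.bottK X v = ∑ i : Fin (k + 1), (-1) ^ (i : ℕ) • P.preBott X (v i) (i.removeNth v) :=
  AlternatingMap.alternatizeUncurryFin_apply _ _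

theorem bottK_cons_smul {k : ℕ} (X : P.Form k) (f : R) (x : P.A) (v : Fin k → P.A) :
    P.bottK X (Fin.cons (f • x) v) = f • P.bottK X (Fin.cons x v) := by
  cases k with
  | zero =>
    simp [bottK_apply, preBott_smul_left]
  | succ k =>
    have h0 : ∀ y : P.A, (0 : Fin (k + 2)).removeNth (Fin.cons y v : Fin (k + 2) → P.A) = v := by
      intro y; rfl
    have hs : ∀ (l : Fin (k + 1)) (y : P.A),
        l.succ.removeNth (Fin.cons y v : Fin (k + 2) → P.A) =
          Function.update (Fin.cons 0 (l.removeNth v) : Fin (k + 1) → P.A) 0 y := by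
      intro l y
      rw [Fin.update_cons_zero]
      funext j
      refine Fin.cases ?_ (fun j => ?_) j
      · simp [Fin.removeNth]
      · simp [Fin.removeNth]
    have hX : ∀ l : Fin (k + 1), X (Function.update v l x) =
        (-1) ^ (l : ℕ) • X (Function.update (Fin.cons 0 (l.removeNth v) : Fin (k + 1) → P.A) 0 x)
        := by
      intro l
      rw [Fin.update_cons_zero, ← Fin.insertNth_removeNth, X.map_insertNth]
      rfl
    simp only [bottK_apply, Fin.sum_univ_succ (n := k + 1), Fin.cons_zero, Fin.cons_succ, h0, hs,
      preBott_smul_left, preBott_smul_slot, smul_add, hX, Finset.sum_add_distrib,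
      Finset.smul_sum, Fin.val_zero, pow_zero, one_smul, Fin.val_succ, pow_succ]
    have h1 : ∀ (l : ℕ) (g : R) (y : P.B), (((-1) ^ l * -1 : ℤ)) • (2 : K)⁻¹ • g • y =
        -((2 : K)⁻¹ • g • ((-1) ^ l : ℤ) • y) := by
      intro l g y
      rw [mul_neg_one, neg_smul, smul_comm, smul_comm _ g]
    have h2 : ∀ (l : ℕ) (y : P.B), (((-1) ^ l * -1 : ℤ)) • f • y =
        f • (((-1) ^ l * -1 : ℤ)) • y := fun l y => smul_comm _ _ _
    simp only [h1, h2, Finset.sum_neg_distrib]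
    abel

theorem bottK_smul {k : ℕ} (X : P.Form k) (v : Fin (k + 1) → P.A) (i : Fin (k + 1)) (f : R)
    (x : P.A) : P.bottK X (Function.update v i (f • x)) =
      f • P.bottK X (Function.update v i x) := by
  rw [← Fin.insertNth_removeNth i (f • x) v, ← Fin.insertNth_removeNth i x v, AlternatingMap.map_insertNth,
    AlternatingMap.map_insertNth, smul_comm f]
  congr 1
  exact P.bottK_cons_smul X f x _

/-- The Chevalley–Eilenberg differential of the Bott connection, from degree `k` to degree
`k + 1`. -/
noncomputable def dBott (k : ℕ) : P.Form k →ₗ[K] P.Form (k + 1) where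
  toFun X := extendR (P.bottK X) (P.bottK_smul X)
  map_add' X Y := by
    ext v
    have h : ∀ a w, P.preBott (X + Y) a w = P.preBott X a w + P.preBott Y a w := by
      intro a w
      simp only [preBott_apply, AlternatingMap.add_apply, map_add, Finset.sum_add_distrib,
        smul_add]
      abel
    simp only [extendR_apply, bottK_apply, h, AlternatingMap.add_apply, smul_add,
      Finset.sum_add_distrib]
  map_smul' c X := by
    ext v
    have h : ∀ a w, P.preBott (c • X) a w = c • P.preBott X a w := by
      intro a w
      simp only [preBott_apply, AlternatingMap.smul_apply, map_smul, ← Finset.smul_sum, smul_sub]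
      rw [smul_comm c]
    simp only [extendR_apply, bottK_apply, h, AlternatingMap.smul_apply, RingHom.id_apply,
      Finset.smul_sum]
    congr 1
    refine Finset.sum_congr rfl fun i _ => ?_
    rw [smul_comm c]

end Unary

section Binary

/-- The summand of the binary bracket:
`∑ᵢ X(u₁,…,ð_{Y(w)} uᵢ,…,u_p) - ∑ⱼ Y(w₁,…,ð_{X(u)} wⱼ,…,w_q) + [X(u), Y(w)]_B`. -/
noncomputable def pre₂Fun {p q : ℕ} (X : P.Form p) (Y : P.Form q) (u : Fin p → P.A)
    (w : Fin q → P.A) : P.B :=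
  ∑ i, X (Function.update u i (P.eth (Y w) (u i)))
    - ∑ j, Y (Function.update w j (P.eth (X u) (w j)))
    + P.brB (X u) (Y w)

theorem pre₂Fun_eq {p q : ℕ} (X : P.Form p) (Y : P.Form q) (u : Fin p → P.A)
    (w : Fin q → P.A) : P.pre₂Fun X Y u w = slotSum (P.eth (Y w)) (restrictK X) u
      - slotSum (P.eth (X u)) (restrictK Y) w + P.brB (X u) (Y w) := rfl

theorem pre₂Fun_swap {p q : ℕ} (X : P.Form p) (Y : P.Form q) (u : Fin p → P.A)
    (w : Fin q → P.A) : P.pre₂Fun X Y u w = - P.pre₂Fun Y X w u := by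
  have : P.brB (X u) (Y w) = - P.brB (Y w) (X u) := by
    simp only [brB_apply]
    rw [P.bracket_skew, map_neg]
  rw [pre₂Fun, pre₂Fun, this]
  abel

theorem pre₂Fun_update_add {p q : ℕ} (X : P.Form p) (Y : P.Form q) (u : Fin p → P.A)
    (w : Fin q → P.A) (i : Fin p) (x y : P.A) :
    P.pre₂Fun X Y (Function.update u i (x + y)) w =
      P.pre₂Fun X Y (Function.update u i x) w + P.pre₂Fun X Y (Function.update u i y) w := by
  simp only [pre₂Fun_eq, AlternatingMap.map_update_add, map_add, LinearMap.add_apply]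
  have h : ∀ b b' : P.B, slotSum (P.eth b + P.eth b') (restrictK Y) w =
      slotSum (P.eth b) (restrictK Y) w + slotSum (P.eth b') (restrictK Y) w := by
    intro b b'
    simp only [slotSum_apply, LinearMap.add_apply, AlternatingMap.map_update_add,
      Finset.sum_add_distrib]
  rw [h]
  abel

theorem pre₂Fun_update_smul {p q : ℕ} (X : P.Form p) (Y : P.Form q) (u : Fin p → P.A)
    (w : Fin q → P.A) (i : Fin p) (f : R) (x : P.A) :
    P.pre₂Fun X Y (Function.update u i (f • x)) w =
      f • P.pre₂Fun X Y (Function.update u i x) w := by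
  have h : ∀ b : P.B, slotSum (P.eth (f • b)) (restrictK Y) w =
      f • slotSum (P.eth b) (restrictK Y) w := by
    intro b
    simp only [slotSum_apply, restrictK_apply, eth_smul_left, AlternatingMap.map_update_smul,
      Finset.smul_sum]
  rw [pre₂Fun_eq, pre₂Fun_eq, slotSum_smul X (P.eth (Y w)) (P.anchor (Y w : L))
    (fun f x => P.eth_smul_right f _ x), X.map_update_smul, h, brB_smul_left, smul_add, smul_sub]
  abel

/-- `pre₂Fun` as an `R`-multilinear map in the `p + q` arguments `(u, w)`. -/
noncomputable def pre₂ {p q : ℕ} (X : P.Form p) (Y : P.Form q) :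
    MultilinearMap R (fun _ : Fin p ⊕ Fin q => P.A) P.B where
  toFun v := P.pre₂Fun X Y (v ∘ Sum.inl) (v ∘ Sum.inr)
  map_update_add' := by
    rintro inst v (i | j) x y
    · simp only [Sum.update_inl_comp_inl, Sum.update_inl_comp_inr, pre₂Fun_update_add]
    · simp only [Sum.update_inr_comp_inl, Sum.update_inr_comp_inr]
      rw [pre₂Fun_swap, pre₂Fun_update_add, neg_add, ← pre₂Fun_swap, ← pre₂Fun_swap]
  map_update_smul' := by
    rintro inst v (i | j) c x
    · simp only [Sum.update_inl_comp_inl, Sum.update_inl_comp_inr, pre₂Fun_update_smul]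
    · simp only [Sum.update_inr_comp_inl, Sum.update_inr_comp_inr]
      rw [pre₂Fun_swap, pre₂Fun_update_smul, ← smul_neg, ← pre₂Fun_swap]

theorem pre₂Fun_add_left {p q : ℕ} (X X' : P.Form p) (Y : P.Form q) (u : Fin p → P.A)
    (w : Fin q → P.A) : P.pre₂Fun (X + X') Y u w = P.pre₂Fun X Y u w + P.pre₂Fun X' Y u w := by
  simp only [pre₂Fun, AlternatingMap.add_apply, map_add, LinearMap.add_apply,
    AlternatingMap.map_update_add, Finset.sum_add_distrib]
  abel

theorem pre₂Fun_smul_left {p q : ℕ} (c : K) (X : P.Form p) (Y : P.Form q) (u : Fin p → P.A)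
    (w : Fin q → P.A) : P.pre₂Fun (c • X) Y u w = c • P.pre₂Fun X Y u w := by
  have h : ∀ j y, Y (Function.update w j (c • y)) = c • Y (Function.update w j y) :=
    fun j y => (restrictK (K := K) Y).map_update_smul w j c y
  simp only [pre₂Fun, AlternatingMap.smul_apply, map_smul, LinearMap.smul_apply, h,
    smul_add, smul_sub, Finset.smul_sum]

/-- The binary bracket of forms of degrees `p` and `q`: the sum over the `(p, q)`-shuffles of the
`p + q` arguments, with signs, of `pre₂`. -/
noncomputable def bracket₂ (p q : ℕ) : P.Form p →ₗ[K] P.Form q →ₗ[K] P.Form (p + q) :=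
  LinearMap.mk₂ K
    (fun X Y => antisymmetrize K ((factorial p * factorial q : K)⁻¹) finSumFinEquiv (P.pre₂ X Y))
    (fun X X' Y => by
      rw [← antisymm_add]
      congr 1
      ext1 v
      exact P.pre₂Fun_add_left X X' Y _ _)
    (fun c X Y => by
      rw [← antisymm_smul]
      congr 1
      ext1 v
      exact P.pre₂Fun_smul_left c X Y _ _)
    (fun X Y Y' => by
      rw [← antisymm_add]
      congr 1
      ext1 v
      change P.pre₂Fun _ _ _ _ = P.pre₂Fun _ _ _ _ + P.pre₂Fun _ _ _ _
      rw [pre₂Fun_swap, pre₂Fun_add_left, neg_add, ← pre₂Fun_swap, ← pre₂Fun_swap])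
    (fun c X Y => by
      rw [← antisymm_smul]
      congr 1
      ext1 v
      change P.pre₂Fun _ _ _ _ = c • P.pre₂Fun _ _ _ _
      rw [pre₂Fun_swap, pre₂Fun_smul_left, ← smul_neg, ← pre₂Fun_swap])

end Binary

section Trilinear

variable {X₁ X₂ X₃ G G' : Type*} [AddCommMonoid X₁] [Module K X₁] [AddCommMonoid X₂] [Module K X₂]
  [AddCommMonoid X₃] [Module K X₃] [AddCommMonoid G] [Module K G] [AddCommMonoid G'] [Module K G']

/-- Postcomposition of a trilinear map with a linear map. -/
def comp₃ (f : X₁ →ₗ[K] X₂ →ₗ[K] X₃ →ₗ[K] G) (g : G →ₗ[K] G') :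
    X₁ →ₗ[K] X₂ →ₗ[K] X₃ →ₗ[K] G' where
  toFun x := (f x).compr₂ g
  map_add' x y := by ext; simp
  map_smul' c x := by ext; simp

@[simp] theorem comp₃_apply (f : X₁ →ₗ[K] X₂ →ₗ[K] X₃ →ₗ[K] G) (g : G →ₗ[K] G') (x : X₁)
    (y : X₂) (z : X₃) : comp₃ f g x y z = g (f x y z) := rfl

/-- `(swap₂₃ f)(x, z, y) = f(x, y, z)`. -/
def swap₂₃ (f : X₁ →ₗ[K] X₂ →ₗ[K] X₃ →ₗ[K] G) : X₁ →ₗ[K] X₃ →ₗ[K] X₂ →ₗ[K] G where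
  toFun x := (f x).flip
  map_add' x y := by ext; simp
  map_smul' c x := by ext; simp

@[simp] theorem swap₂₃_apply (f : X₁ →ₗ[K] X₂ →ₗ[K] X₃ →ₗ[K] G) (x : X₁)
    (y : X₂) (z : X₃) : swap₂₃ f x z y = f x y z := rfl

/-- `(rotate₃ f)(z, x, y) = f(x, y, z)`. -/
def rotate₃ (f : X₁ →ₗ[K] X₂ →ₗ[K] X₃ →ₗ[K] G) : X₃ →ₗ[K] X₁ →ₗ[K] X₂ →ₗ[K] G :=
  (swap₂₃ f).flip

@[simp] theorem rotate₃_apply (f : X₁ →ₗ[K] X₂ →ₗ[K] X₃ →ₗ[K] G) (x : X₁)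
    (y : X₂) (z : X₃) : rotate₃ f z x y = f x y z := rfl

end Trilinear

section Ternary

theorem curryLeft_smul {V W : Submodule R L} {k : ℕ} (Z : V [⋀^Fin (k + 1)]→ₗ[R] W) (c : K)
    (a : V) (w : Fin k → V) : Z.curryLeft (c • a) w = c • Z.curryLeft a w := by
  rw [← algebraMap_smul R c a, map_smul, AlternatingMap.smul_apply, algebraMap_smul]

/-- `antisymmetrize` as a linear operator. -/
noncomputable def antisymmetrizeL {ι : Type*} [Fintype ι] {n : ℕ} (c : K) (e : ι ≃ Fin n) :
    MultilinearMap R (fun _ : ι => P.A) P.B →ₗ[K] P.Form n where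
  toFun := antisymmetrize K c e
  map_add' H H' := antisymm_add K c e H H'
  map_smul' a H := antisymm_smul K c e a H

/-- The summand of the ternary bracket: the multilinear map `(u, w, t) ↦ Z(β(X(u), Y(w)), t)`. -/
noncomputable def pre₃ {p q r : ℕ} (X : P.Form p) (Y : P.Form q) (Z : P.Form (r + 1)) :
    MultilinearMap R (fun _ : (Fin p ⊕ Fin q) ⊕ Fin r => P.A) P.B where
  toFun v := Z.curryLeft
    (P.beta (X ((v ∘ Sum.inl) ∘ Sum.inl)) (Y ((v ∘ Sum.inl) ∘ Sum.inr))) (v ∘ Sum.inr)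
  map_update_add' := by
    rintro inst v ((i | i) | i) x y <;>
      simp only [Sum.update_inl_comp_inl, Sum.update_inl_comp_inr, Sum.update_inr_comp_inl,
        Sum.update_inr_comp_inr, AlternatingMap.map_update_add, map_add, LinearMap.add_apply,
        AlternatingMap.add_apply]
  map_update_smul' := by
    rintro inst v ((i | i) | i) c x <;>
      simp only [Sum.update_inl_comp_inl, Sum.update_inl_comp_inr, Sum.update_inr_comp_inl,
        Sum.update_inr_comp_inr, AlternatingMap.map_update_smul, map_smul, LinearMap.smul_apply,
        AlternatingMap.smul_apply]

/-- `pre₃` as a trilinear map. -/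
noncomputable def pre₃L (p q r : ℕ) : P.Form p →ₗ[K] P.Form q →ₗ[K] P.Form (r + 1) →ₗ[K]
    MultilinearMap R (fun _ : (Fin p ⊕ Fin q) ⊕ Fin r => P.A) P.B where
  toFun X := LinearMap.mk₂ K (P.pre₃ X)
    (fun Y Y' Z => by
      ext1 v
      simp only [pre₃, MultilinearMap.coe_mk, add_apply, map_add, AlternatingMap.add_apply])
    (fun c Y Z => by
      ext1 v
      simp only [pre₃, MultilinearMap.coe_mk, smul_apply, AlternatingMap.smul_apply,
        LinearMap.map_smul_of_tower, curryLeft_smul])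
    (fun Y Z Z' => rfl)
    (fun c Y Z => rfl)
  map_add' X X' := by
    refine LinearMap.ext fun Y => LinearMap.ext fun Z => MultilinearMap.ext fun v => ?_
    change P.pre₃ (X + X') Y Z v = P.pre₃ X Y Z v + P.pre₃ X' Y Z v
    simp only [pre₃, MultilinearMap.coe_mk, map_add, AlternatingMap.add_apply,
      LinearMap.add_apply]
  map_smul' c X := by
    refine LinearMap.ext fun Y => LinearMap.ext fun Z => MultilinearMap.ext fun v => ?_
    change P.pre₃ (c • X) Y Z v = c • P.pre₃ X Y Z v
    simp only [pre₃, MultilinearMap.coe_mk, AlternatingMap.smul_apply,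
      LinearMap.smul_apply, LinearMap.map_smul_of_tower, curryLeft_smul]

/-- Three consecutive blocks of sizes `p`, `q` and `r`. -/
def blocks (p q r : ℕ) : (Fin p ⊕ Fin q) ⊕ Fin r ≃ Fin (p + q + r) :=
  (Equiv.sumCongr finSumFinEquiv (Equiv.refl _)).trans finSumFinEquiv

/-- First part of the ternary bracket: `(-1)^(p+q+1)` times the sum over the
`(p, q, r-1)`-shuffles of `± Z(β(X(a₁,…), Y(a_{p+1},…)), a_{p+q+1},…)`; it vanishes if `r = 0`. -/
noncomputable def term₁ (p q : ℕ) :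
    ∀ r : ℕ, P.Form p →ₗ[K] P.Form q →ₗ[K] P.Form r →ₗ[K] P.Forms
  | 0 => 0
  | r + 1 => (-1 : K) ^ (p + q + 1) • comp₃ (P.pre₃L p q r)
      (DirectSum.lof K ℕ P.Form (p + q + r) ∘ₗ
        P.antisymmetrizeL (factorial p * factorial q * factorial r : K)⁻¹ (blocks p q r))

/-- Second part of the ternary bracket: `(-1)^p` times the sum over the `(p, q-1, r)`-shuffles of
`± Y(β(X(a₁,…), Z(a_{p+q},…)), a_{p+1},…)`; it vanishes if `q = 0`. The equivalence only restores
the order of the blocks: `X`, remaining arguments of `Y`, `Z`. -/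
noncomputable def term₂ (p : ℕ) :
    ∀ q r : ℕ, P.Form p →ₗ[K] P.Form q →ₗ[K] P.Form r →ₗ[K] P.Forms
  | 0, _ => 0
  | q + 1, r => (-1 : K) ^ p • comp₃ (swap₂₃ (P.pre₃L p r q))
      (DirectSum.lof K ℕ P.Form (p + q + r) ∘ₗ
        P.antisymmetrizeL (factorial p * factorial q * factorial r : K)⁻¹
          ((((Equiv.sumAssoc _ _ _).trans
            (Equiv.sumCongr (Equiv.refl _) (Equiv.sumComm _ _))).trans
              (Equiv.sumAssoc _ _ _).symm).trans (blocks p q r)))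

/-- Third part of the ternary bracket: minus the sum over the `(p-1, q, r)`-shuffles of
`± X(β(Y(a_p,…), Z(a_{p+q},…)), a₁,…)`; it vanishes if `p = 0`. The equivalence only restores the
order of the blocks: remaining arguments of `X`, `Y`, `Z`. -/
noncomputable def term₃ :
    ∀ p q r : ℕ, P.Form p →ₗ[K] P.Form q →ₗ[K] P.Form r →ₗ[K] P.Forms
  | 0, _, _ => 0
  | p + 1, q, r => (-1 : K) • comp₃ (rotate₃ (P.pre₃L q r p))
      (DirectSum.lof K ℕ P.Form (p + q + r) ∘ₗ
        P.antisymmetrizeL (factorial p * factorial q * factorial r : K)⁻¹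
          (((Equiv.sumComm _ _).trans (Equiv.sumAssoc _ _ _).symm).trans (blocks p q r)))

end Ternary

section Action

/-- The `R`-linear map `a ↦ pr_B δ(a)` from `A` to `B`. -/
noncomputable def derAB : P.der →ₗ[K] P.A →ₗ[R] P.B where
  toFun δ :=
    { toFun a := P.prB ((δ : L →ₗ[K] L) a)
      map_add' a a' := by simp
      map_smul' f a := by
        obtain ⟨s, h, -⟩ := δ.2
        simp [h] }
  map_add' δ δ' := by ext a; simp
  map_smul' c δ := by ext a; simp

/-- The `R`-linear map `b ↦ pr_A δ(b)` from `B` to `A`. -/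
noncomputable def derBA : P.der →ₗ[K] P.B →ₗ[R] P.A where
  toFun δ :=
    { toFun b := P.prA ((δ : L →ₗ[K] L) b)
      map_add' a a' := by simp
      map_smul' f a := by
        obtain ⟨s, h, -⟩ := δ.2
        simp [h] }
  map_add' δ δ' := by ext a; simp
  map_smul' c δ := by ext a; simp

/-- `κ(δ)(a) = - pr_B δ(a)`. -/
noncomputable def kappa : P.der →ₗ[K] P.Form 1 where
  toFun δ := AlternatingMap.ofSubsingleton R P.A P.B (0 : Fin 1) (- P.derAB δ)
  map_add' δ δ' := by
    ext v
    simp [AlternatingMap.ofSubsingleton, add_comm]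
  map_smul' c δ := by
    ext v
    simp [AlternatingMap.ofSubsingleton]

/-- The operator `a ↦ pr_A δ(a)` on `A`. -/
noncomputable def derAA (δ : P.der) : P.A →ₗ[K] P.A :=
  P.prA.restrictScalars K ∘ₗ (δ : L →ₗ[K] L) ∘ₗ P.A.subtype.restrictScalars K

/-- The operator `b ↦ pr_B δ(b)` on `B`. -/
noncomputable def derBB (δ : P.der) : P.B →ₗ[K] P.B :=
  P.prB.restrictScalars K ∘ₗ (δ : L →ₗ[K] L) ∘ₗ P.B.subtype.restrictScalars K

/-- The action of a derivation on forms of degree `k`: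
`(δ ▷ X)(v₁,…,vₖ) = pr_B δ(X(v₁,…,vₖ)) - ∑ⱼ X(v₁,…,pr_A δ(vⱼ),…,vₖ)`. -/
noncomputable def act₁ (k : ℕ) : P.der →ₗ[K] P.Form k →ₗ[K] P.Form k :=
  LinearMap.mk₂ K
    (fun δ X => extendR ((P.derBB δ).compAlternatingMap (restrictK X)
        - slotSum (P.derAA δ) (restrictK X)) (by
      intro v i f x
      obtain ⟨s, h, -⟩ := δ.2
      have h1 := slotSum_smul X (P.derAA δ) s (fun f x => by simp [derAA, h]) v i f x
      simp only [AlternatingMap.sub_apply, LinearMap.compAlternatingMap_apply, h1,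
        restrictK_apply, X.map_update_smul]
      simp only [derBB, LinearMap.comp_apply, LinearMap.restrictScalars_apply,
        Submodule.subtype_apply, h, map_add, map_smul, prB_B]
      rw [smul_sub]
      abel))
    (fun δ δ' X => by
      ext1 v
      have h : ∀ j y y', X (Function.update v j (y + y')) =
        X (Function.update v j y) + X (Function.update v j y') := fun j y y' =>
          X.map_update_add v j y y'
      simp only [extendR_apply, AlternatingMap.sub_apply, LinearMap.compAlternatingMap_apply,
        AlternatingMap.add_apply, restrictK_apply, slotSum_apply, derAA, derBB,
        LinearMap.comp_apply, Submodule.coe_add, LinearMap.add_apply, map_add, h,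
        Finset.sum_add_distrib]
      abel)
    (fun c δ X => by
      ext1 v
      have h : ∀ j y, X (Function.update v j (c • y)) = c • X (Function.update v j y) :=
        fun j y => (restrictK (K := K) X).map_update_smul v j c y
      simp only [extendR_apply, AlternatingMap.sub_apply, LinearMap.compAlternatingMap_apply,
        AlternatingMap.smul_apply, restrictK_apply, slotSum_apply, derAA, derBB,
        LinearMap.comp_apply, Submodule.coe_smul, LinearMap.smul_apply, map_smul, h,
        ← Finset.smul_sum, smul_sub])
    (fun δ X X' => by
      ext1 v
      simp only [extendR_apply, AlternatingMap.sub_apply, LinearMap.compAlternatingMap_apply,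
        AlternatingMap.add_apply, restrictK_apply, slotSum_apply, map_add,
        Finset.sum_add_distrib]
      abel)
    (fun c δ X => by
      ext1 v
      simp only [extendR_apply, AlternatingMap.sub_apply, LinearMap.compAlternatingMap_apply,
        AlternatingMap.smul_apply, restrictK_apply, slotSum_apply, map_smul,
        ← Finset.smul_sum, smul_sub])

/-- The multilinear map `(u, w) ↦ Y(φ(X(u)), w)`. -/
def preAct {i j : ℕ} (φ : P.B →ₗ[R] P.A) (X : P.Form i) (Y : P.Form (j + 1)) :
    MultilinearMap R (fun _ : Fin i ⊕ Fin j => P.A) P.B where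
  toFun v := Y.curryLeft (φ (X (v ∘ Sum.inl))) (v ∘ Sum.inr)
  map_update_add' := by
    rintro inst v (i | i) x y <;>
      simp only [Sum.update_inl_comp_inl, Sum.update_inl_comp_inr, Sum.update_inr_comp_inl,
        Sum.update_inr_comp_inr, AlternatingMap.map_update_add, map_add, LinearMap.add_apply,
        AlternatingMap.add_apply]
  map_update_smul' := by
    rintro inst v (i | i) c x <;>
      simp only [Sum.update_inl_comp_inl, Sum.update_inl_comp_inr, Sum.update_inr_comp_inl,
        Sum.update_inr_comp_inr, AlternatingMap.map_update_smul, map_smul, LinearMap.smul_apply,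
        AlternatingMap.smul_apply]

/-- `preAct` as a trilinear map. -/
def preActL (i j : ℕ) : (P.B →ₗ[R] P.A) →ₗ[K] P.Form i →ₗ[K] P.Form (j + 1) →ₗ[K]
    MultilinearMap R (fun _ : Fin i ⊕ Fin j => P.A) P.B where
  toFun φ := LinearMap.mk₂ K (P.preAct φ)
    (fun Y Y' Z => by
      ext1 v
      simp only [preAct, MultilinearMap.coe_mk, add_apply, map_add, AlternatingMap.add_apply])
    (fun c Y Z => by
      ext1 v
      simp only [preAct, MultilinearMap.coe_mk, smul_apply, AlternatingMap.smul_apply,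
        LinearMap.map_smul_of_tower, curryLeft_smul])
    (fun Y Z Z' => rfl)
    (fun c Y Z => rfl)
  map_add' X X' := by
    refine LinearMap.ext fun Y => LinearMap.ext fun Z => MultilinearMap.ext fun v => ?_
    change P.preAct (X + X') Y Z v = P.preAct X Y Z v + P.preAct X' Y Z v
    simp only [preAct, MultilinearMap.coe_mk, map_add, AlternatingMap.add_apply,
      LinearMap.add_apply]
  map_smul' c X := by
    refine LinearMap.ext fun Y => LinearMap.ext fun Z => MultilinearMap.ext fun v => ?_
    change P.preAct (c • X) Y Z v = c • P.preAct X Y Z v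
    simp only [preAct, MultilinearMap.coe_mk,
      LinearMap.smul_apply, curryLeft_smul]

/-- First part of the binary action `δ ▷ (X, Y)`: `(-1)^(i+1)` times the sum over the
`(i, j-1)`-shuffles of `± Y(pr_A δ(X(a₁,…,aᵢ)), a_{i+1},…)`; it vanishes if `j = 0`. -/
noncomputable def actTerm₁ (i : ℕ) :
    ∀ j : ℕ, P.der →ₗ[K] P.Form i →ₗ[K] P.Form j →ₗ[K] P.Forms
  | 0 => 0
  | j + 1 => (-1 : K) ^ (i + 1) • comp₃ (P.preActL i j ∘ₗ P.derBA)
      (DirectSum.lof K ℕ P.Form (i + j) ∘ₗ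
        P.antisymmetrizeL (factorial i * factorial j : K)⁻¹ finSumFinEquiv)

/-- Second part of the binary action `δ ▷ (X, Y)`: the sum over the `(i-1, j)`-shuffles of
`± X(pr_A δ(Y(aᵢ,…)), a₁,…,a_{i-1})`; it vanishes if `i = 0`. -/
noncomputable def actTerm₂ :
    ∀ i j : ℕ, P.der →ₗ[K] P.Form i →ₗ[K] P.Form j →ₗ[K] P.Forms
  | 0, _ => 0
  | i + 1, j => comp₃ (swap₂₃ (P.preActL j i ∘ₗ P.derBA))
      (DirectSum.lof K ℕ P.Form (i + j) ∘ₗ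
        P.antisymmetrizeL (factorial i * factorial j : K)⁻¹ ((Equiv.sumComm _ _).trans finSumFinEquiv))

end Action

section Total

variable {ι : Type*} [DecidableEq ι] {Φ : ι → Type*} [∀ i, AddCommMonoid (Φ i)]
  [∀ i, Module K (Φ i)] {X₁ X₂ G : Type*} [AddCommMonoid X₁] [Module K X₁]
  [AddCommMonoid X₂] [Module K X₂] [AddCommMonoid G] [Module K G]

/-- Linear extension to a direct sum, in the first variable. -/
noncomputable def sum₁ (f : ∀ i, Φ i →ₗ[K] G) : (⨁ i, Φ i) →ₗ[K] G :=
  DirectSum.toModule K ι G f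

/-- Linear extension to a direct sum, in the second variable. -/
noncomputable def sum₂ (f : ∀ i, X₁ →ₗ[K] Φ i →ₗ[K] G) : X₁ →ₗ[K] (⨁ i, Φ i) →ₗ[K] G :=
  (sum₁ fun i => (f i).flip).flip

/-- Linear extension to a direct sum, in the third variable. -/
noncomputable def sum₃ (f : ∀ i, X₁ →ₗ[K] X₂ →ₗ[K] Φ i →ₗ[K] G) :
    X₁ →ₗ[K] X₂ →ₗ[K] (⨁ i, Φ i) →ₗ[K] G :=
  rotate₃ (rotate₃ (sum₁ fun i => rotate₃ (f i)))

end Total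

/-- The unary bracket of `Ω_A(B)`, the Chevalley–Eilenberg differential. -/
noncomputable def d [CharZero K] : P.Forms →ₗ[K] P.Forms :=
  sum₁ fun k => DirectSum.lof K ℕ P.Form (k + 1) ∘ₗ P.dBott k

/-- The binary bracket `[·,·]₂` of `Ω_A(B)`. -/
noncomputable def br₂ : P.Forms →ₗ[K] P.Forms →ₗ[K] P.Forms :=
  sum₁ fun p => sum₂ fun q => (P.bracket₂ p q).compr₂ (DirectSum.lof K ℕ P.Form (p + q))

/-- The ternary bracket `[·,·,·]₃` of `Ω_A(B)`. -/
noncomputable def br₃ : P.Forms →ₗ[K] P.Forms →ₗ[K] P.Forms →ₗ[K] P.Forms :=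
  sum₁ fun p => sum₂ fun q => sum₃ fun r => P.term₁ p q r + P.term₂ p q r + P.term₃ p q r

/-- The `0`-action `κ : Der(L) → Ω¹_A(B)`. -/
noncomputable def κ : P.der →ₗ[K] P.Forms := DirectSum.lof K ℕ P.Form 1 ∘ₗ P.kappa

/-- The `1`-action `(δ, X) ↦ δ ▷ X`. -/
noncomputable def μ₁ : P.der →ₗ[K] P.Forms →ₗ[K] P.Forms :=
  sum₂ fun k => (P.act₁ k).compr₂ (DirectSum.lof K ℕ P.Form k)

/-- The `2`-action `(δ, X, Y) ↦ δ ▷ (X, Y)`. -/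
noncomputable def μ₂ : P.der →ₗ[K] P.Forms →ₗ[K] P.Forms →ₗ[K] P.Forms :=
  sum₂ fun i => sum₃ fun j => P.actTerm₁ i j + P.actTerm₂ i j

/-- Elements of `B` as forms of degree `0`. -/
noncomputable def ofB : P.B →ₗ[K] P.Forms :=
  DirectSum.lof K ℕ P.Form 0 ∘ₗ
    { toFun := fun b => AlternatingMap.constOfIsEmpty R P.A (Fin 0) b
      map_add' := fun _ _ => rfl
      map_smul' := fun _ _ => rfl }

/-! Coefficients in the maximal ideal `𝔪` of a local `K`-algebra `𝒜`. -/

section Tensor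

variable (𝒜 : Type*) [CommRing 𝒜] [Algebra K 𝒜] [IsLocalRing 𝒜]

/-- The maximal ideal of `𝒜`. -/
abbrev 𝔪 : Type _ := ↥(IsLocalRing.maximalIdeal 𝒜)

variable (K) in
/-- The multiplication `𝔪 × 𝒜 → 𝔪`. -/
def mulRing : 𝔪 𝒜 →ₗ[K] 𝒜 →ₗ[K] 𝔪 𝒜 :=
  LinearMap.mk₂ K (fun s t => t • s) (fun _ _ _ => smul_add _ _ _) (fun _ _ _ => smul_comm _ _ _)
    (fun _ _ _ => add_smul _ _ _) (fun _ _ _ => smul_assoc _ _ _)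

variable (K) in
/-- The multiplication `𝔪 × 𝔪 → 𝔪`. -/
def mul₂ : 𝔪 𝒜 →ₗ[K] 𝔪 𝒜 →ₗ[K] 𝔪 𝒜 :=
  (mulRing K 𝒜).compl₂ ((IsLocalRing.maximalIdeal 𝒜).subtype.restrictScalars K)

variable (K) in
/-- The multiplication `(s, t, u) ↦ s t u` of `𝔪`. -/
def mul₃ : 𝔪 𝒜 →ₗ[K] 𝔪 𝒜 →ₗ[K] 𝔪 𝒜 →ₗ[K] 𝔪 𝒜 :=
  (mul₂ K 𝒜).compr₂ (mul₂ K 𝒜)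

variable {X₁ X₂ X₃ G : Type*} [AddCommMonoid X₁] [Module K X₁] [AddCommMonoid X₂] [Module K X₂]
  [AddCommMonoid X₃] [Module K X₃] [AddCommMonoid G] [Module K G]

/-- The `𝒜`-linear extension `f(x ⊗ s) = f(x) ⊗ s` of a linear map. -/
noncomputable def ext₁ (f : X₁ →ₗ[K] G) : X₁ ⊗[K] 𝔪 𝒜 →ₗ[K] G ⊗[K] 𝔪 𝒜 :=
  TensorProduct.map f LinearMap.id

/-- The extension `f(x ⊗ s, y ⊗ t) = f(x, y) ⊗ s t` of a bilinear map. -/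
noncomputable def ext₂ (f : X₁ →ₗ[K] X₂ →ₗ[K] G) :
    X₁ ⊗[K] 𝔪 𝒜 →ₗ[K] X₂ ⊗[K] 𝔪 𝒜 →ₗ[K] G ⊗[K] 𝔪 𝒜 :=
  TensorProduct.map₂ f (mul₂ K 𝒜)

/-- The extension `f(x ⊗ s, y ⊗ t, z ⊗ u) = f(x, y, z) ⊗ s t u` of a trilinear map. -/
noncomputable def ext₃ (f : X₁ →ₗ[K] X₂ →ₗ[K] X₃ →ₗ[K] G) :
    X₁ ⊗[K] 𝔪 𝒜 →ₗ[K] X₂ ⊗[K] 𝔪 𝒜 →ₗ[K] X₃ ⊗[K] 𝔪 𝒜 →ₗ[K] G ⊗[K] 𝔪 𝒜 :=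
  (TensorProduct.map₂ f (mul₃ K 𝒜)).compr₂ (TensorProduct.homTensorHomMap (RingHom.id K) _ _ _ _)

theorem ext₃_tmul (f : X₁ →ₗ[K] X₂ →ₗ[K] X₃ →ₗ[K] G) (x : X₁) (y : X₂) (z : X₃) (s t u : 𝔪 𝒜) :
    ext₃ 𝒜 f (x ⊗ₜ s) (y ⊗ₜ t) (z ⊗ₜ u) = f x y z ⊗ₜ mul₃ K 𝒜 s t u := rfl

/-- Elements of `B ⊗ 𝔪` as forms of degree `0` with coefficients in `𝔪`. -/
noncomputable def ofBCoeff : P.B ⊗[K] 𝔪 𝒜 →ₗ[K] P.Forms ⊗[K] 𝔪 𝒜 :=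
  ext₁ 𝒜 P.ofB

/-- The operator `ad_b = [b,·]_L` of `b ∈ B ⊗ 𝔪`: for `b = b₀ ⊗ s` it sends `u ⊗ t` to
`[b₀, u] ⊗ s t`. Here `u ⊗ t` runs over `L ⊗ 𝒜`; the operator takes values in `L ⊗ 𝔪`. -/
noncomputable def adOp (b : P.B ⊗[K] 𝔪 𝒜) : L ⊗[K] 𝒜 →ₗ[K] L ⊗[K] 𝔪 𝒜 :=
  TensorProduct.map₂ (P.bracket ∘ₗ P.B.subtype.restrictScalars K) (mulRing K 𝒜) b

/-- The operator of `δ ∈ Der(L) ⊗ 𝔪`: for `δ = δ₀ ⊗ s` it sends `u ⊗ t ∈ L ⊗ 𝒜` to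
`δ₀(u) ⊗ s t ∈ L ⊗ 𝔪`. -/
noncomputable def derOp (δ : P.der ⊗[K] 𝔪 𝒜) : L ⊗[K] 𝒜 →ₗ[K] L ⊗[K] 𝔪 𝒜 :=
  TensorProduct.map₂ P.der.subtype (mulRing K 𝒜) δ

/-- The brackets `[x₁,…,xₖ]ₖ` of `Ω_A(B) ⊗ 𝔪`, for all `k`; those of arity above `3` vanish (and
there is no bracket of arity `0`). -/
noncomputable def brackets [CharZero K] : List (P.Forms ⊗[K] 𝔪 𝒜) → P.Forms ⊗[K] 𝔪 𝒜
  | [x] => ext₁ 𝒜 P.d x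
  | [x, y] => ext₂ 𝒜 P.br₂ x y
  | [x, y, z] => ext₃ 𝒜 P.br₃ x y z
  | _ => 0

/-- The actions `δ ▷ (x₁,…,xₖ)` of `δ ∈ Der(L) ⊗ 𝔪` on `Ω_A(B) ⊗ 𝔪`, for all `k ≥ 0` (with
`κ(δ)` for `k = 0`); those with `k > 2` vanish. -/
noncomputable def actions (δ : P.der ⊗[K] 𝔪 𝒜) :
    List (P.Forms ⊗[K] 𝔪 𝒜) → P.Forms ⊗[K] 𝔪 𝒜
  | [] => ext₁ 𝒜 P.κ δ
  | [x] => ext₂ 𝒜 P.μ₁ δ x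
  | [x, y] => ext₃ 𝒜 P.μ₂ δ x y
  | _ => 0

end Tensor

/-! Maurer–Cartan elements and gauge actions. Here `br` is a family of brackets of all arities,
given as a function of the list of arguments, and likewise `act` is a family of actions of a fixed
element. All the sums over `k` and `j` have finitely many nonzero terms when they are used. -/

section Gauge

variable (K) {G : Type*} [AddCommGroup G] [Module K G]

/-- The twisted bracket `[x₁,…,xᵢ]^ξ = ∑_{k ≥ 0} (1/k!) [ξ,…,ξ,x₁,…,xᵢ]`, with `k` copies of
`ξ`. -/
noncomputable def twist (br : List G → G) (ξ : G) (x : List G) : G :=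
  ∑ᶠ k : ℕ, (factorial k : K)⁻¹ • br (List.replicate k ξ ++ x)

/-- The Maurer–Cartan equation `∑_{k ≥ 1} (1/k!) [ξ,…,ξ]ₖ = 0`. -/
def IsMC (br : List G → G) (ξ : G) : Prop :=
  ∑ᶠ k : ℕ, (factorial (k + 1) : K)⁻¹ • br (List.replicate (k + 1) ξ) = 0

/-- The multinomial coefficient `k! / (k₁! ⋯ kₙ!)` of a composition `k = k₁ + ⋯ + kₙ`. -/
noncomputable def multinom {k : ℕ} (c : Composition k) : K :=
  (factorial k : K) / ∏ i, (factorial (c.blocksFun i) : K)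

/-- The elements `e^k_ξ(b)`, `k ≥ 1`: one has `e^1_ξ(b) = [b]^ξ` and `e^{k+1}_ξ(b)` is the sum over
all compositions `k = k₁ + ⋯ + kₙ` into positive parts (`n` is the number of parts) of
`(1/n!) · k!/(k₁! ⋯ kₙ!) · [b, e^{k₁}_ξ(b),…,e^{kₙ}_ξ(b)]^ξ`. (The value at `k = 0` is not used.) -/
noncomputable def gaugeTerm (br : List G → G) (ξ b : G) : ℕ → G
  | 0 => 0
  | 1 => twist K br ξ [b]
  | k + 2 => ∑ c : Composition (k + 1), ((factorial c.length : K)⁻¹ * multinom K c) •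
      twist K br ξ (b :: List.ofFn fun i =>
        have : c.blocksFun i < k + 2 := Nat.lt_succ_of_le (c.blocksFun_le i)
        gaugeTerm br ξ b (c.blocksFun i))

/-- The gauge action `e^b * ξ = ξ - ∑_{k ≥ 1} (1/k!) e^k_ξ(b)`. -/
noncomputable def gaugeAction (br : List G → G) (b ξ : G) : G :=
  ξ - ∑ᶠ k : ℕ, (factorial (k + 1) : K)⁻¹ • gaugeTerm K br ξ b (k + 1)

/-- The sum `∑_{j ≥ 0} ((-1)^j/j!) δ ▷ (ξ,…,ξ,x₁,…,xᵢ)`, with `j` copies of `ξ`. -/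
noncomputable def actTwist (act : List G → G) (ξ : G) (x : List G) : G :=
  ∑ᶠ j : ℕ, ((-1 : K) ^ j / (factorial j : K)) • act (List.replicate j ξ ++ x)

/-- The elements `e^k_ξ(δ)`, `k ≥ 1`, for an action: `e^1_ξ(δ) = ∑_j ((-1)^j/j!) δ ▷ (ξ,…,ξ)` and
`e^{k+1}_ξ(δ)` is the sum over all compositions `k = k₁ + ⋯ + kₙ` into positive parts of
`(1/n!) · k!/(k₁! ⋯ kₙ!) · ∑_j ((-1)^j/j!) δ ▷ (ξ,…,ξ,e^{k₁}_ξ(δ),…,e^{kₙ}_ξ(δ))`. (The value at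
`k = 0` is not used.) -/
noncomputable def actGaugeTerm (act : List G → G) (ξ : G) : ℕ → G
  | 0 => 0
  | 1 => actTwist K act ξ []
  | k + 2 => ∑ c : Composition (k + 1), ((factorial c.length : K)⁻¹ * multinom K c) •
      actTwist K act ξ (List.ofFn fun i =>
        have : c.blocksFun i < k + 2 := Nat.lt_succ_of_le (c.blocksFun_le i)
        actGaugeTerm act ξ (c.blocksFun i))

/-- The gauge action `e^δ * ξ = ξ - ∑_{k ≥ 1} (1/k!) e^k_ξ(δ)` of an action. -/
noncomputable def actGaugeAction (act : List G → G) (ξ : G) : G :=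
  ξ - ∑ᶠ k : ℕ, (factorial (k + 1) : K)⁻¹ • actGaugeTerm K act ξ (k + 1)

end Gauge

/-- The additive group underlying the `K`-module `Ω_A(B) ⊗ 𝔪`. -/
noncomputable instance instAddCommGroupForms (𝒜 : Type*) [CommRing 𝒜] [Algebra K 𝒜] [IsLocalRing 𝒜] :
    AddCommGroup (P.Forms ⊗[K] 𝔪 𝒜) := Module.addCommMonoidToAddCommGroup K

/-- The Maurer–Cartan elements: the elements `ξ` of `Ω¹_A(B) ⊗ 𝔪` that satisfy the Maurer–Cartan
equation. -/
noncomputable def MC [CharZero K] (𝒜 : Type*) [CommRing 𝒜] [Algebra K 𝒜] [IsLocalRing 𝒜] :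
    Set (P.Forms ⊗[K] 𝔪 𝒜) :=
  {ξ | ξ ∈ LinearMap.range (ext₁ 𝒜 (DirectSum.lof K ℕ P.Form 1)) ∧ IsMC K (P.brackets 𝒜) ξ}

end SplitLiePair

/-! # Smooth vector bundles and Lie algebroids -/

section Geometry


/-- The subalgebra of smooth functions among all the functions from `M` to `𝕂`. -/
def smoothFunctions (𝕂 : Type*) [RCLike 𝕂] (n : ℕ) (M : Type*) [TopologicalSpace M]
    [ChartedSpace (EuclideanSpace ℝ (Fin n)) M] : Subalgebra 𝕂 (M → 𝕂) where
  carrier := {f | ContMDiff (𝓡 n) 𝓘(ℝ, 𝕂) ∞ f}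
  mul_mem' := fun hf hg => contDiff_mul.contMDiff.comp (ContMDiff.prodMk_space hf hg)
  add_mem' := fun hf hg => hf.add hg
  algebraMap_mem' := fun _ => contMDiff_const

variable (𝕂 : Type*) [RCLike 𝕂] (n : ℕ) {M : Type*} [TopologicalSpace M]
    [ChartedSpace (EuclideanSpace ℝ (Fin n)) M]
  (F : Type*) [NormedAddCommGroup F] [NormedSpace ℝ F] [NormedSpace 𝕂 F] [IsScalarTower ℝ 𝕂 F]
  (E : M → Type*) [∀ x, AddCommGroup (E x)] [∀ x, Module ℝ (E x)] [∀ x, Module 𝕂 (E x)]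
  [∀ x, TopologicalSpace (E x)] [TopologicalSpace (Bundle.TotalSpace F E)]
  [FiberBundle F E] [VectorBundle ℝ F E] [VectorBundle 𝕂 F E]

/-- The smooth sections of `E` among all its sections. -/
def smoothSections : Submodule (smoothFunctions 𝕂 n M) (∀ x, E x) where
  carrier := {u | ContMDiff (𝓡 n) ((𝓡 n).prod 𝓘(ℝ, F)) ∞
    fun x => Bundle.TotalSpace.mk' F x (u x)}
  add_mem' := fun hu hv => hu.add_section hv
  zero_mem' := Bundle.contMDiff_zeroSection ℝ E
  smul_mem' := by
    rintro ⟨f, hf⟩ u hu x₀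
    have hf := (hf : ContMDiff (𝓡 n) 𝓘(ℝ, 𝕂) ∞ f) x₀
    have hu := (hu : ContMDiff (𝓡 n) ((𝓡 n).prod 𝓘(ℝ, F)) ∞
      fun x => Bundle.TotalSpace.mk' F x (u x)) x₀
    rw [Bundle.contMDiffAt_section] at hu ⊢
    set e := trivializationAt F E x₀
    have hs : ContMDiffAt (𝓡 n) 𝓘(ℝ, F) ∞ (fun x => f x • (e ⟨x, u x⟩).2) x₀ := by
      have h : ContDiff ℝ ∞ (fun p : 𝕂 × F => p.1 • p.2) :=
        (ContinuousLinearMap.lsmul ℝ 𝕂 : 𝕂 →L[ℝ] F →L[ℝ] F).isBoundedBilinearMap.contDiff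
      exact h.contMDiff.contMDiffAt.comp x₀ (ContMDiffAt.prodMk_space hf hu)
    refine hs.congr_of_eventuallyEq ?_
    filter_upwards [e.open_baseSet.mem_nhds (FiberBundle.mem_baseSet_trivializationAt' x₀)]
      with x hx
    exact (e.linear 𝕂 hx).2 _ _

variable (M) in
/-- The algebra `C^∞(M, 𝕂)` of smooth `𝕂`-valued functions. -/
def SmoothFun : Type _ := smoothFunctions 𝕂 n M

/-- The `C^∞(M, 𝕂)`-module `Γ(E)` of smooth sections of `E`. -/
def SmoothSec : Type _ := smoothSections 𝕂 n F E

variable (M) in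
noncomputable instance : CommRing (SmoothFun 𝕂 n M) :=
  inferInstanceAs (CommRing (smoothFunctions 𝕂 n M))

variable (M) in
noncomputable instance : Algebra 𝕂 (SmoothFun 𝕂 n M) :=
  inferInstanceAs (Algebra 𝕂 (smoothFunctions 𝕂 n M))

noncomputable instance : AddCommGroup (SmoothSec 𝕂 n F E) :=
  inferInstanceAs (AddCommGroup (smoothSections 𝕂 n F E))

noncomputable instance : Module (SmoothFun 𝕂 n M) (SmoothSec 𝕂 n F E) :=
  inferInstanceAs (Module (smoothFunctions 𝕂 n M) (smoothSections 𝕂 n F E))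

noncomputable instance : Module 𝕂 (SmoothSec 𝕂 n F E) :=
  Module.compHom _ (algebraMap 𝕂 (SmoothFun 𝕂 n M))

instance : IsScalarTower 𝕂 (SmoothFun 𝕂 n M) (SmoothSec 𝕂 n F E) :=
  ⟨fun c f u => by
    change (c • f) • u = (algebraMap 𝕂 (SmoothFun 𝕂 n M) c) • f • u
    rw [Algebra.smul_def, mul_smul]⟩

@[simp] theorem SmoothSec.smul_apply (c : 𝕂) (u : SmoothSec 𝕂 n F E) (x : M) :
    (c • u).1 x = c • u.1 x := rfl

/-- The smooth sections of `E` with values in a given family of subspaces of the fibres. -/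
def secIn (A : ∀ x, Submodule 𝕂 (E x)) : Submodule (SmoothFun 𝕂 n M) (SmoothSec 𝕂 n F E) where
  carrier := {u | ∀ x, u.1 x ∈ A x}
  add_mem' := fun hu hv x => (A x).add_mem (hu x) (hv x)
  zero_mem' := fun x => (A x).zero_mem
  smul_mem' := fun f _ hu x => (A x).smul_mem (f.1 x) (hu x)

/-- A Lie algebroid structure on the vector bundle `E`, with a Lie subalgebroid `A` and a
complement `B` of `A` in `E`.

The anchor, a morphism of vector bundles from `E` to `TM ⊗ 𝕂`, is given by the corresponding
`C^∞(M, 𝕂)`-linear map from `Γ(E)` to the `𝕂`-linear derivations of `C^∞(M, 𝕂)`, which are the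
sections of `TM ⊗ 𝕂`. That `A` and `B` are smooth subbundles is expressed by the
smoothness of the projection of `E = A ⊕ B` onto `A`. -/
structure SplitLieAlgebroid extends LieRinehart 𝕂 (SmoothFun 𝕂 n M) (SmoothSec 𝕂 n F E) where
  A : ∀ x, Submodule 𝕂 (E x)
  B : ∀ x, Submodule 𝕂 (E x)
  isCompl : ∀ x, IsCompl (A x) (B x)
  smooth_proj : ∀ u ∈ smoothSections 𝕂 n F E,
    (fun x => ((A x).projectionOnto (B x) (isCompl x) (u x) : E x)) ∈ smoothSections 𝕂 n F E
  bracket_mem : ∀ u ∈ secIn 𝕂 n F E A, ∀ v ∈ secIn 𝕂 n F E A, bracket u v ∈ secIn 𝕂 n F E A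

variable {𝕂 n F E} in
/-- The Lie–Rinehart algebra `Γ(E) = Γ(A) ⊕ Γ(B)` of a split Lie algebroid pair. -/
def SplitLieAlgebroid.toSplitLiePair (P : SplitLieAlgebroid 𝕂 n F E) :
    SplitLiePair 𝕂 (SmoothFun 𝕂 n M) (SmoothSec 𝕂 n F E) where
  toLieRinehart := P.toLieRinehart
  A := secIn 𝕂 n F E P.A
  B := secIn 𝕂 n F E P.B
  isCompl := by
    refine ⟨disjoint_iff_inf_le.2 fun u hu => ?_, codisjoint_iff_le_sup.2 fun u _ => ?_⟩
    · refine (Submodule.mem_bot _).2 (Subtype.ext (funext fun x => ?_))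
      exact Submodule.disjoint_def.1 (P.isCompl x).disjoint _ (hu.1 x) (hu.2 x)
    · set w : SmoothSec 𝕂 n F E := ⟨_, P.smooth_proj u.1 u.2⟩ with hw
      refine Submodule.mem_sup.2 ⟨w, fun x => Subtype.coe_prop _, u - w, fun x => ?_, by abel⟩
      change u.1 x - ((P.A x).projectionOnto (P.B x) (P.isCompl x) (u.1 x) : E x) ∈ P.B x
      rw [← Submodule.projectionOnto_apply_eq_zero_iff (P.isCompl x), map_sub,
        Submodule.projectionOnto_apply_left, sub_self]
  bracket_mem := P.bracket_mem

end Geometry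

/-! For `b` in `B`, the Leibniz and Jacobi identities say that `[b, ·]` is a derivation whose symbol
is the anchor of `b`. This gives a `K`-linear map `adDer` from `B` to `P.der`, and for `b` with
coefficients in `𝔪` the element `ext₁ 𝒜 P.adDer b` induces `ad_b`. Uniqueness is `derOp_injective`:
in a `K`-basis of `𝔪`, the values of an operator at the elements `u ⊗ 1` display the components of
the element of `Der(L) ⊗ 𝔪` that induces it.

The actions of `ad_b` are brackets with `b` because the components of `[b, ·]` along `L = A ⊕ B` are
the structure maps of the brackets: `pr_A [b,a] = ð_b a`, `pr_B [b,a] = -∇_a b`, `pr_A [b,b'] =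
β(b,b')` and `pr_B [b,b'] = [b,b']_B`. As a form of degree 0, `b` takes no arguments, so its block
in every shuffle is empty and the sums on the two sides match (`kappa_adDer`, `μ₁_adDer`,
`μ₂_adDer`). Linearity carries these identities to coefficients.

The two gauge recursions then differ in one point only. In the twisted bracket, `j` copies of `ξ`
stand in front of `b`; in the action, the derivation comes first and the sum carries the sign
`(-1)^j`. Moving a form of degree 0 past a form of degree 1 costs a factor `-1`, so the two agree
(`brackets_append_cons`, `twist_ofBCoeff`), and strong induction on `k` identifies the terms `e^k`
(`gaugeTerm_ofBCoeff`).

This argument needs every `e^k` to be a form of degree 1. The filtration `oneForms` records that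
together with powers of `𝔪`: each application of the derivation contributes one factor from `𝔪`,
hence `e^k` has coefficients in `𝔪ᵏ` (`actGaugeTerm_mem`). Since `𝔪` is nilpotent, almost all `e^k`
vanish. -/

namespace SplitLiePair

/-! ### Inner derivations, and brackets with a form of degree 0, before extension of coefficients.
-/

section Adjoint

variable {K R L : Type*} [Field K] [CommRing R] [Algebra K R]
    [AddCommGroup L] [Module K L] [Module R L] [IsScalarTower K R L] (P : SplitLiePair K R L)

/-- The inner derivations `[b, ·]` of `L` for `b ∈ B`. -/
noncomputable def adDer : P.B →ₗ[K] P.der :=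
  (P.bracket ∘ₗ P.B.subtype.restrictScalars K).codRestrict P.der fun b =>
    ⟨P.anchor b, fun f u => by simpa using P.leibniz b u f,
      fun u => (P.anchor_bracket b u).symm, fun u v => P.jacobi b u v⟩

theorem derAA_adDer (b : P.B) : P.derAA (P.adDer b) = P.eth b := rfl

theorem derBB_adDer (b : P.B) : P.derBB (P.adDer b) = P.brB b := rfl

theorem ofB_apply (b : P.B) :
    P.ofB b = DirectSum.lof K ℕ P.Form 0 (AlternatingMap.constOfIsEmpty R P.A (Fin 0) b) := rfl

/-- Degrees such as `0 + q` and `q` are equal only propositionally, so forms of these degrees are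
compared inside the direct sum. It suffices to compare the kernels before antisymmetrization. -/
theorem lof_antisymmetrize_congr {ι ι' : Type*} [Fintype ι] [Fintype ι'] {m n : ℕ} (h : m = n)
    {c c' : K} (hc : c = c') (e : ι ≃ Fin m) (e' : ι' ≃ Fin n)
    (H : MultilinearMap R (fun _ : ι => P.A) P.B) (H' : MultilinearMap R (fun _ : ι' => P.A) P.B)
    (hH : ∀ v : Fin n → P.A, H (fun i => v (Fin.cast h (e i))) = H' (fun i => v (e' i))) :
    DirectSum.lof K ℕ P.Form m (antisymmetrize K c e H) =
      DirectSum.lof K ℕ P.Form n (antisymmetrize K c' e' H') := by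
  subst h hc
  have : H.domDomCongr e = H'.domDomCongr e' := MultilinearMap.ext hH
  rw [antisymmetrize, antisymmetrize, this]

/-- All `n!` signed permutations of an alternating map coincide, and the factor `1 / n!` cancels
their number. -/
theorem antisymmetrize_of_alternating [CharZero K] {ι : Type*} [Fintype ι] {n : ℕ}
    (e : ι ≃ Fin n) (H : MultilinearMap R (fun _ : ι => P.A) P.B) (X : P.Form n)
    (hX : ∀ v : Fin n → P.A, H (fun i => v (e i)) = X v) :
    antisymmetrize K (factorial n : K)⁻¹ e H = X := by
  have : H.domDomCongr e = X.toMultilinearMap := MultilinearMap.ext hX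
  rw [antisymmetrize, this]
  have h := AlternatingMap.coe_alternatization X
  simp only [Fintype.card_fin] at h
  have h' : MultilinearMap.alternatization X.toMultilinearMap = (factorial n : K) • X := by
    rw [h, Nat.cast_smul_eq_nsmul]
  rw [h', smul_smul, inv_mul_cancel₀ (by exact_mod_cast Nat.factorial_ne_zero n), one_smul]

section Total

variable {ι : Type*} [DecidableEq ι] {Φ : ι → Type*} [∀ i, AddCommMonoid (Φ i)]
  [∀ i, Module K (Φ i)] {X₁ X₂ G : Type*} [AddCommMonoid X₁] [Module K X₁]
  [AddCommMonoid X₂] [Module K X₂] [AddCommMonoid G] [Module K G]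

@[simp] theorem sum₁_lof (f : ∀ i, Φ i →ₗ[K] G) (i : ι) (x : Φ i) :
    sum₁ f (DirectSum.lof K ι Φ i x) = f i x :=
  DirectSum.toModule_lof K i x

@[simp] theorem sum₂_lof (f : ∀ i, X₁ →ₗ[K] Φ i →ₗ[K] G) (x : X₁) (i : ι) (y : Φ i) :
    sum₂ f x (DirectSum.lof K ι Φ i y) = f i x y := by
  simp [sum₂]

@[simp] theorem sum₃_lof (f : ∀ i, X₁ →ₗ[K] X₂ →ₗ[K] Φ i →ₗ[K] G) (x : X₁) (y : X₂) (i : ι)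
    (z : Φ i) : sum₃ f x y (DirectSum.lof K ι Φ i z) = f i x y z := by
  change sum₁ (fun i => rotate₃ (f i)) (DirectSum.lof K ι Φ i z) x y = _
  rw [sum₁_lof]; rfl

end Total

theorem br₂_lof {p q : ℕ} (X : P.Form p) (Y : P.Form q) :
    P.br₂ (DirectSum.lof K ℕ P.Form p X) (DirectSum.lof K ℕ P.Form q Y) =
      DirectSum.lof K ℕ P.Form (p + q) (P.bracket₂ p q X Y) := by
  simp [br₂]

theorem br₃_lof {p q r : ℕ} (X : P.Form p) (Y : P.Form q) (Z : P.Form r) :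
    P.br₃ (DirectSum.lof K ℕ P.Form p X) (DirectSum.lof K ℕ P.Form q Y)
      (DirectSum.lof K ℕ P.Form r Z) =
      P.term₁ p q r X Y Z + P.term₂ p q r X Y Z + P.term₃ p q r X Y Z := by
  simp [br₃]

theorem μ₁_lof {q : ℕ} (δ : P.der) (Y : P.Form q) :
    P.μ₁ δ (DirectSum.lof K ℕ P.Form q Y) = DirectSum.lof K ℕ P.Form q (P.act₁ q δ Y) := by
  simp [μ₁]

theorem μ₂_lof {p q : ℕ} (δ : P.der) (X : P.Form p) (Y : P.Form q) :
    P.μ₂ δ (DirectSum.lof K ℕ P.Form p X) (DirectSum.lof K ℕ P.Form q Y) =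
      P.actTerm₁ p q δ X Y + P.actTerm₂ p q δ X Y := by
  simp [μ₂]

/-! ### The three actions of an inner derivation as brackets. -/

theorem kappa_adDer [CharZero K] (b : P.B) : P.κ (P.adDer b) = P.d (P.ofB b) := by
  simp only [κ, d, ofB_apply, sum₁_lof, LinearMap.comp_apply]
  congr 1
  ext1 v
  change - P.prB (P.bracket b (v 0)) = P.bottK _ v
  simp only [bottK_apply, preBott_apply]
  simp [nabla_apply]
  -- The sign in the definition of `κ` turns `[b,a]` into `[a,b]`, whose `B`-component is the Bott
  -- connection.
  rw [P.bracket_skew, map_neg, neg_neg]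

theorem act₁_apply {k : ℕ} (δ : P.der) (X : P.Form k) (v : Fin k → P.A) :
    P.act₁ k δ X v = P.derBB δ (X v) - ∑ j, X (Function.update v j (P.derAA δ (v j))) := rfl

theorem μ₁_adDer [CharZero K] (b : P.B) (X : P.Forms) :
    P.μ₁ (P.adDer b) X = P.br₂ (P.ofB b) X := by
  refine LinearMap.congr_fun (DirectSum.linearMap_ext (ι := ℕ) (M := P.Form) K fun q => ?_) X
  refine LinearMap.ext fun Y => ?_
  simp only [LinearMap.comp_apply]
  rw [μ₁_lof, ofB_apply, br₂_lof]
  symm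
  change DirectSum.lof K ℕ P.Form (0 + q) (antisymmetrize K _ finSumFinEquiv (P.pre₂ _ Y)) = _
  have hc : ((factorial 0 * factorial q : K)⁻¹) = (factorial q : K)⁻¹ := by simp
  -- With the block of `b` empty, the summand of the binary bracket is already alternating in the
  -- arguments of `Y`. So `ad_b ▷ Y` is itself its normalized antisymmetrization, and only the
  -- indexing by `0 + q` remains to be compared.
  rw [← P.antisymmetrize_of_alternating (Equiv.emptySum (Fin 0) (Fin q)) (P.pre₂ _ Y)
    (P.act₁ q (P.adDer b) Y) (fun v => ?_)]
  · refine P.lof_antisymmetrize_congr (zero_add q) hc _ _ _ _ fun v => ?_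
    congr 1
    funext i
    rcases i with i | i
    · exact i.elim0
    · congr 1; ext; simp
  · change P.pre₂Fun _ Y _ _ = _
    rw [act₁_apply, derAA_adDer, derBB_adDer, pre₂Fun]
    simp [sub_eq_add_neg, add_comm]
    rfl

/-- The `A`-component of `ad_b` on `B` is `β(b, ·)`, so the two sums of the action are the two parts
of the ternary bracket in which `b` is fed into `β`. The signs agree because `b` has degree 0. -/
theorem μ₂_adDer (b : P.B) (X Y : P.Forms) :
    P.μ₂ (P.adDer b) X Y = P.br₃ (P.ofB b) X Y := by
  refine LinearMap.congr_fun₂ (DirectSum.linearMap_ext (ι := ℕ) (M := P.Form) K fun p => ?_) X Y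
  refine LinearMap.ext fun X => ?_
  refine DirectSum.linearMap_ext (ι := ℕ) (M := P.Form) K fun q => ?_
  refine LinearMap.ext fun Y => ?_
  simp only [LinearMap.comp_apply]
  rw [μ₂_lof, ofB_apply, br₃_lof]
  have h₁ : P.actTerm₁ p q (P.adDer b) X Y =
      P.term₁ 0 p q (AlternatingMap.constOfIsEmpty R P.A (Fin 0) b) X Y := by
    cases q with
    | zero => rfl
    | succ q =>
      change (-1 : K) ^ (p + 1) • DirectSum.lof K ℕ P.Form (p + q) (antisymmetrize K _ _
          (P.preAct (P.derBA (P.adDer b)) X Y)) =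
        (-1 : K) ^ (0 + p + 1) • DirectSum.lof K ℕ P.Form (0 + p + q) (antisymmetrize K _ _
          (P.pre₃ _ X Y))
      rw [show (-1 : K) ^ (0 + p + 1) = (-1) ^ (p + 1) by rw [zero_add]]
      congr 1
      symm
      refine P.lof_antisymmetrize_congr (by rw [zero_add]) (by simp) _ _ _ _ fun v => ?_
      -- Both kernels are `Y(β(b, X(u)), w)`; what is left is that the blocks of sizes `(0, p, q)`
      -- and `(p, q)` list the arguments in the same order.
      refine congrArg₂ (fun u w => Y.curryLeft (P.beta b (X u)) w)
        (funext fun i => congrArg v (Fin.ext ?_)) (funext fun i => congrArg v (Fin.ext ?_)) <;>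
      simp [blocks]
  have h₂ : P.actTerm₂ p q (P.adDer b) X Y =
      P.term₂ 0 p q (AlternatingMap.constOfIsEmpty R P.A (Fin 0) b) X Y := by
    cases p with
    | zero => rfl
    | succ p =>
      change DirectSum.lof K ℕ P.Form (p + q) (antisymmetrize K _ _
          (P.preAct (P.derBA (P.adDer b)) Y X)) =
        (-1 : K) ^ 0 • DirectSum.lof K ℕ P.Form (0 + p + q) (antisymmetrize K _ _
          (P.pre₃ _ Y X))
      rw [pow_zero, one_smul]
      symm
      refine P.lof_antisymmetrize_congr (by rw [zero_add]) (by simp) _ _ _ _ fun v => ?_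
      refine congrArg₂ (fun u w => X.curryLeft (P.beta b (Y u)) w)
        (funext fun i => congrArg v (Fin.ext ?_)) (funext fun i => congrArg v (Fin.ext ?_)) <;>
      simp [blocks]
  rw [h₁, h₂]
  -- The third part of the bracket would insert `β(X, Y)` into `b`, and it vanishes since `b` has no
  -- slot.
  exact (add_zero _).symm

/-! ### Graded symmetry of the brackets for one entry of degree 0 and the others of degree 1. -/

theorem lof_antisymmetrize_one {ι : Type*} [Fintype ι] {m : ℕ} (hm : m = 1) {c : K} (hc : c = 1)
    (e : ι ≃ Fin m) (H : MultilinearMap R (fun _ : ι => P.A) P.B) (W : P.Form 1)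
    (hW : ∀ a : P.A, H (fun _ => a) = W (fun _ => a)) :
    DirectSum.lof K ℕ P.Form m (antisymmetrize K c e H) = DirectSum.lof K ℕ P.Form 1 W := by
  subst hm hc
  congr 1
  ext1 v
  obtain ⟨a, rfl⟩ : ∃ a, v = fun _ => a := ⟨v 0, funext fun i => congrArg v (Subsingleton.elim _ _)⟩
  rw [antisymmetrize, AlternatingMap.smul_apply, MultilinearMap.alternatization_apply, ← hW]
  simp

/-- The result has a single argument, so no shuffles intervene, and the sign is the skew-symmetry of
`pre₂Fun`. -/
theorem br₂_ofB_right [CharZero K] (X : P.Form 1) (b : P.B) :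
    P.br₂ (DirectSum.lof K ℕ P.Form 1 X) (P.ofB b) =
      (-1 : K) • P.br₂ (P.ofB b) (DirectSum.lof K ℕ P.Form 1 X) := by
  rw [← μ₁_adDer, μ₁_lof, ofB_apply, br₂_lof, ← map_smul]
  change DirectSum.lof K ℕ P.Form (1 + 0) (antisymmetrize K (factorial 1 * factorial 0 : K)⁻¹
    finSumFinEquiv (P.pre₂ X (AlternatingMap.constOfIsEmpty R P.A (Fin 0) b))) = _
  refine P.lof_antisymmetrize_one rfl (by simp) _ _ _ fun a => ?_
  change P.pre₂Fun X _ _ _ = (-1 : K) • (P.act₁ 1 (P.adDer b) X _)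
  rw [neg_one_smul, pre₂Fun_swap, pre₂Fun, act₁_apply, derAA_adDer, derBB_adDer]
  simp [sub_eq_add_neg, add_comm]
  rfl

/-- The form `a ↦ Y(β(b, X(a)))` of degree `1`. -/
noncomputable def betaForm (b : P.B) (X Y : P.Form 1) : P.Form 1 :=
  AlternatingMap.ofSubsingleton R P.A P.B (0 : Fin 1)
    ((AlternatingMap.ofSubsingleton R P.A P.B (0 : Fin 1)).symm Y ∘ₗ P.beta b ∘ₗ
      (AlternatingMap.ofSubsingleton R P.A P.B (0 : Fin 1)).symm X)

theorem cons_eq_const {V : Type*} (x : V) (w : Fin 0 → V) : Fin.cons x w = fun _ : Fin 1 => x := by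
  funext i
  rw [Fin.fin_one_eq_zero i]
  rfl

theorem beta_swap (b b' : P.B) : P.beta b b' = - P.beta b' b := by
  change P.prA (P.bracket b b') = - P.prA (P.bracket b' b)
  rw [P.bracket_skew, map_neg]

theorem apply_const_neg (X : P.Form 1) (a : P.A) : X (fun _ => -a) = - X (fun _ => a) :=
  map_neg ((AlternatingMap.ofSubsingleton R P.A P.B (0 : Fin 1)).symm X) a

/-- An explicit form of the bracket, symmetric in `X` and `Y`, against which the other two positions
of `b` are compared. -/
theorem br₃_ofB_left (b : P.B) (X Y : P.Form 1) :
    P.br₃ (P.ofB b) (DirectSum.lof K ℕ P.Form 1 X) (DirectSum.lof K ℕ P.Form 1 Y) =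
      DirectSum.lof K ℕ P.Form 1 (P.betaForm b X Y) +
        DirectSum.lof K ℕ P.Form 1 (P.betaForm b Y X) := by
  rw [ofB_apply, br₃_lof]
  set c := AlternatingMap.constOfIsEmpty R P.A (Fin 0) b
  change (-1 : K) ^ 2 • DirectSum.lof K ℕ P.Form _ (antisymmetrize K _ _ (P.pre₃ c X Y)) +
    (-1 : K) ^ 0 • DirectSum.lof K ℕ P.Form _ (antisymmetrize K _ _ (P.pre₃ c Y X)) + 0 = _
  rw [P.lof_antisymmetrize_one rfl (by simp) _ (P.pre₃ c X Y) (P.betaForm b X Y),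
    P.lof_antisymmetrize_one rfl (by simp) _ (P.pre₃ c Y X) (P.betaForm b Y X)]
  · simp
  · exact fun a => congrArg X (cons_eq_const _ _)
  · exact fun a => congrArg Y (cons_eq_const _ _)

theorem br₃_ofB_middle (b : P.B) (X Y : P.Form 1) :
    P.br₃ (DirectSum.lof K ℕ P.Form 1 X) (P.ofB b) (DirectSum.lof K ℕ P.Form 1 Y) =
      (-1 : K) • P.br₃ (P.ofB b) (DirectSum.lof K ℕ P.Form 1 X) (DirectSum.lof K ℕ P.Form 1 Y) := by
  rw [br₃_ofB_left, ofB_apply, br₃_lof]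
  set c := AlternatingMap.constOfIsEmpty R P.A (Fin 0) b
  -- The part that inserts into the form of degree 0 is zero. Of the other two, the first contains
  -- `β(X, b)` and changes sign when `b` is put in front; the second carries the sign `-1` already.
  change (-1 : K) ^ 2 • DirectSum.lof K ℕ P.Form _ (antisymmetrize K _ _ (P.pre₃ X c Y)) + 0 +
    (-1 : K) • DirectSum.lof K ℕ P.Form _ (antisymmetrize K _ _ (P.pre₃ c Y X)) = _
  rw [P.lof_antisymmetrize_one rfl (by simp) _ (P.pre₃ X c Y) ((-1 : K) • P.betaForm b X Y),
    P.lof_antisymmetrize_one rfl (by simp) _ (P.pre₃ c Y X) (P.betaForm b Y X)]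
  · rw [map_smul, smul_add, add_zero, smul_smul]
    norm_num
  · exact fun a => congrArg X (cons_eq_const _ _)
  · intro a
    refine (congrArg Y (cons_eq_const _ _)).trans ?_
    rw [beta_swap, apply_const_neg, ← neg_one_smul K]
    rfl

theorem br₃_ofB_right (b : P.B) (X Y : P.Form 1) :
    P.br₃ (DirectSum.lof K ℕ P.Form 1 X) (DirectSum.lof K ℕ P.Form 1 Y) (P.ofB b) =
      P.br₃ (P.ofB b) (DirectSum.lof K ℕ P.Form 1 X) (DirectSum.lof K ℕ P.Form 1 Y) := by
  rw [br₃_ofB_left, ofB_apply, br₃_lof]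
  set c := AlternatingMap.constOfIsEmpty R P.A (Fin 0) b
  -- Both surviving parts have coefficient `-1` and have `b` as second entry of `β`, so the two
  -- signs cancel in each.
  change 0 + (-1 : K) ^ 1 • DirectSum.lof K ℕ P.Form _ (antisymmetrize K _ _ (P.pre₃ X c Y)) +
    (-1 : K) • DirectSum.lof K ℕ P.Form _ (antisymmetrize K _ _ (P.pre₃ Y c X)) = _
  rw [P.lof_antisymmetrize_one rfl (by simp) _ (P.pre₃ X c Y) ((-1 : K) • P.betaForm b X Y),
    P.lof_antisymmetrize_one rfl (by simp) _ (P.pre₃ Y c X) ((-1 : K) • P.betaForm b Y X)]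
  · rw [map_smul, map_smul, smul_smul, smul_smul, zero_add]
    norm_num
  · intro a
    refine (congrArg X (cons_eq_const _ _)).trans ?_
    rw [beta_swap, apply_const_neg, ← neg_one_smul K]
    rfl
  · intro a
    refine (congrArg Y (cons_eq_const _ _)).trans ?_
    rw [beta_swap, apply_const_neg, ← neg_one_smul K]
    rfl

/-- The binary action sends two forms of degree `1` to a form of degree `1`. -/
theorem μ₂_lof_one (δ : P.der) (X Y : P.Form 1) :
    ∃ Z : P.Form 1, P.μ₂ δ (DirectSum.lof K ℕ P.Form 1 X) (DirectSum.lof K ℕ P.Form 1 Y) =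
      DirectSum.lof K ℕ P.Form 1 Z := by
  rw [μ₂_lof]
  refine ⟨(-1 : K) ^ 2 • (antisymmetrize K (factorial 1 * factorial 0 : K)⁻¹ finSumFinEquiv
      (P.preAct (P.derBA δ) X Y) : P.Form (1 + 0)) +
    (antisymmetrize K (factorial 0 * factorial 1 : K)⁻¹ ((Equiv.sumComm _ _).trans finSumFinEquiv)
      (P.preAct (P.derBA δ) Y X) : P.Form (0 + 1)), ?_⟩
  rw [map_add, map_smul]
  rfl

end Adjoint

end SplitLiePair

namespace SplitLiePair

section Coefficients

variable {K : Type*} [Field K] (𝒜 : Type*) [CommRing 𝒜] [Algebra K 𝒜] [IsLocalRing 𝒜]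

/-! ### Extension of multilinear maps to coefficients in the maximal ideal. -/

section Extension

variable {X₀ X₁ X₂ X₃ G : Type*} [AddCommMonoid X₁] [Module K X₁] [AddCommMonoid X₂] [Module K X₂]
  [AddCommMonoid X₃] [Module K X₃] [AddCommMonoid G] [Module K G] [AddCommMonoid X₀] [Module K X₀]

theorem ext₁_ext₁ (f : X₁ →ₗ[K] G) (g : X₀ →ₗ[K] X₁) (x : X₀ ⊗[K] 𝔪 𝒜) :
    ext₁ 𝒜 f (ext₁ 𝒜 g x) = ext₁ 𝒜 (f ∘ₗ g) x := by
  induction x using TensorProduct.induction_on with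
  | zero => simp only [map_zero]
  | tmul x s => rfl
  | add x y hx hy => simp only [map_add, hx, hy]

theorem ext₂_ext₁ (f : X₁ →ₗ[K] X₂ →ₗ[K] G) (g : X₀ →ₗ[K] X₁) (x : X₀ ⊗[K] 𝔪 𝒜) :
    ext₂ 𝒜 f (ext₁ 𝒜 g x) = ext₂ 𝒜 (f ∘ₗ g) x := by
  induction x using TensorProduct.induction_on with
  | zero => simp only [map_zero]
  | tmul x s => rfl
  | add x y hx hy => simp only [map_add, hx, hy]

theorem ext₃_ext₁ (f : X₁ →ₗ[K] X₂ →ₗ[K] X₃ →ₗ[K] G) (g : X₀ →ₗ[K] X₁) (x : X₀ ⊗[K] 𝔪 𝒜) :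
    ext₃ 𝒜 f (ext₁ 𝒜 g x) = ext₃ 𝒜 (f ∘ₗ g) x := by
  induction x using TensorProduct.induction_on with
  | zero => simp only [map_zero]
  | tmul x s => rfl
  | add x y hx hy => simp only [map_add, hx, hy]

theorem ext₂_tmul (f : X₁ →ₗ[K] X₂ →ₗ[K] G) (x : X₁) (y : X₂) (s t : 𝔪 𝒜) :
    ext₂ 𝒜 f (x ⊗ₜ s) (y ⊗ₜ t) = f x y ⊗ₜ mul₂ K 𝒜 s t := rfl

theorem coe_mul₂ (s t : 𝔪 𝒜) : (mul₂ K 𝒜 s t : 𝒜) = s * t := mul_comm _ _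

theorem coe_mul₃ (s t u : 𝔪 𝒜) : (mul₃ K 𝒜 s t u : 𝒜) = s * t * u := by
  change (u : 𝒜) * (t * s) = _
  ring

end Extension

variable {R L : Type*} [CommRing R] [Algebra K R]
    [AddCommGroup L] [Module K L] [Module R L] [IsScalarTower K R L] (P : SplitLiePair K R L)

/-! ### The derivation `ad_b` with coefficients: existence, uniqueness, actions. -/

theorem derOp_zero : P.derOp 𝒜 0 = 0 := map_zero (TensorProduct.map₂ P.der.subtype (mulRing K 𝒜))

theorem derOp_add (δ δ' : P.der ⊗[K] 𝔪 𝒜) : P.derOp 𝒜 (δ + δ') = P.derOp 𝒜 δ + P.derOp 𝒜 δ' :=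
  map_add (TensorProduct.map₂ P.der.subtype (mulRing K 𝒜)) δ δ'

theorem adOp_zero : P.adOp 𝒜 0 = 0 :=
  map_zero (TensorProduct.map₂ (P.bracket ∘ₗ P.B.subtype.restrictScalars K) (mulRing K 𝒜))

theorem adOp_add (b b' : P.B ⊗[K] 𝔪 𝒜) : P.adOp 𝒜 (b + b') = P.adOp 𝒜 b + P.adOp 𝒜 b' :=
  map_add (TensorProduct.map₂ (P.bracket ∘ₗ P.B.subtype.restrictScalars K) (mulRing K 𝒜)) b b'

theorem derOp_injective : Function.Injective (P.derOp 𝒜) := by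
  classical
  -- One basis of `𝔪` gives coordinates on both `Der(L) ⊗ 𝔪` and `L ⊗ 𝔪`. Evaluation at `u ⊗ 1` is
  -- evaluation at `u` in each coordinate, and a derivation is determined by its values.
  let e := TensorProduct.equivFinsuppOfBasisRight (M := P.der) (Module.Basis.ofVectorSpace K (𝔪 𝒜))
  let e' := TensorProduct.equivFinsuppOfBasisRight (M := L) (Module.Basis.ofVectorSpace K (𝔪 𝒜))
  have key : ∀ (δ : P.der ⊗[K] 𝔪 𝒜) (u : L) i,
      e' (P.derOp 𝒜 δ (u ⊗ₜ 1)) i = ((e δ i : P.der) : L →ₗ[K] L) u := by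
    intro δ u i
    induction δ using TensorProduct.induction_on with
    | zero =>
      rw [derOp_zero, LinearMap.zero_apply, LinearEquiv.map_zero, LinearEquiv.map_zero]
      rfl
    | tmul δ s =>
      have h : P.derOp 𝒜 (δ ⊗ₜ s) (u ⊗ₜ 1) = (δ : L →ₗ[K] L) u ⊗ₜ[K] s := by
        change (δ : L →ₗ[K] L) u ⊗ₜ[K] ((1 : 𝒜) • s) = _
        rw [one_smul]
      rw [h, TensorProduct.equivFinsuppOfBasisRight_apply_tmul_apply,
        TensorProduct.equivFinsuppOfBasisRight_apply_tmul_apply]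
      rfl
    | add x y hx hy =>
      rw [derOp_add, LinearMap.add_apply, LinearEquiv.map_add, LinearEquiv.map_add,
        Finsupp.add_apply, Finsupp.add_apply, hx, hy]
      rfl
  intro δ δ' h
  refine e.injective (Finsupp.ext fun i => Subtype.ext (LinearMap.ext fun u => ?_))
  rw [← key, ← key, h]

theorem derOp_adDer (b : P.B ⊗[K] 𝔪 𝒜) : P.derOp 𝒜 (ext₁ 𝒜 P.adDer b) = P.adOp 𝒜 b := by
  induction b using TensorProduct.induction_on with
  | zero => rw [map_zero, derOp_zero, adOp_zero]
  | tmul x s => rfl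
  | add x y hx hy => rw [map_add, derOp_add, adOp_add, hx, hy]

theorem existsUnique_derOp_eq_adOp (b : P.B ⊗[K] 𝔪 𝒜) :
    ∃! δ : P.der ⊗[K] 𝔪 𝒜, P.derOp 𝒜 δ = P.adOp 𝒜 b :=
  ⟨_, P.derOp_adDer 𝒜 b, fun _ h => P.derOp_injective 𝒜 (h.trans (P.derOp_adDer 𝒜 b).symm)⟩

/-- Both sides extend maps that are linear in `b ∈ B`, so the identity is inherited from the one
without coefficients. The next two lemmas follow the same pattern. -/
theorem ext₁_κ_adDer [CharZero K] (b : P.B ⊗[K] 𝔪 𝒜) :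
    ext₁ 𝒜 P.κ (ext₁ 𝒜 P.adDer b) = ext₁ 𝒜 P.d (P.ofBCoeff 𝒜 b) := by
  rw [ofBCoeff, ext₁_ext₁, ext₁_ext₁]
  exact LinearMap.congr_fun (congrArg (ext₁ 𝒜) (LinearMap.ext P.kappa_adDer)) b

theorem ext₂_μ₁_adDer [CharZero K] (b : P.B ⊗[K] 𝔪 𝒜) :
    ext₂ 𝒜 P.μ₁ (ext₁ 𝒜 P.adDer b) = ext₂ 𝒜 P.br₂ (P.ofBCoeff 𝒜 b) := by
  rw [ofBCoeff, ext₂_ext₁, ext₂_ext₁]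
  exact LinearMap.congr_fun
    (congrArg (ext₂ 𝒜) (LinearMap.ext fun b => LinearMap.ext (P.μ₁_adDer b))) b

theorem ext₃_μ₂_adDer (b : P.B ⊗[K] 𝔪 𝒜) :
    ext₃ 𝒜 P.μ₂ (ext₁ 𝒜 P.adDer b) = ext₃ 𝒜 P.br₃ (P.ofBCoeff 𝒜 b) := by
  rw [ofBCoeff, ext₃_ext₁, ext₃_ext₁]
  exact LinearMap.congr_fun
    (congrArg (ext₃ 𝒜) (LinearMap.ext fun b => LinearMap.ext₂ (P.μ₂_adDer b))) b

/-! ### The filtration of the forms of degree 1 by powers of the maximal ideal. -/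

/-- The forms of degree `1` with coefficients in `𝔪 ∩ 𝔪ᵐ`. -/
noncomputable def oneForms (m : ℕ) : Submodule K (P.Forms ⊗[K] 𝔪 𝒜) :=
  Submodule.span K {z | ∃ (X : P.Form 1) (s : 𝔪 𝒜), (s : 𝒜) ∈ IsLocalRing.maximalIdeal 𝒜 ^ m ∧
    z = DirectSum.lof K ℕ P.Form 1 X ⊗ₜ s}

theorem tmul_mem_oneForms {m : ℕ} (X : P.Form 1) (s : 𝔪 𝒜)
    (hs : (s : 𝒜) ∈ IsLocalRing.maximalIdeal 𝒜 ^ m) :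
    DirectSum.lof K ℕ P.Form 1 X ⊗ₜ s ∈ P.oneForms 𝒜 m :=
  Submodule.subset_span ⟨X, s, hs, rfl⟩

theorem oneForms_antitone : Antitone (P.oneForms 𝒜) := fun _ _ h =>
  Submodule.span_mono fun _ ⟨X, s, hs, hz⟩ => ⟨X, s, Ideal.pow_le_pow_right h hs, hz⟩

theorem oneForms_eq_bot {m : ℕ} (h : IsLocalRing.maximalIdeal 𝒜 ^ m = ⊥) : P.oneForms 𝒜 m = ⊥ := by
  refine (Submodule.span_eq_bot (R := K)).2 ?_
  rintro _ ⟨X, s, hs, rfl⟩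
  rw [h, Submodule.mem_bot] at hs
  rw [show s = 0 from Subtype.ext hs, TensorProduct.tmul_zero]

theorem range_ext₁_lof_le :
    LinearMap.range (ext₁ 𝒜 (DirectSum.lof K ℕ P.Form 1)) ≤ P.oneForms 𝒜 0 := by
  rintro _ ⟨x, rfl⟩
  induction x using TensorProduct.induction_on with
  | zero => rw [map_zero]; exact zero_mem _
  | tmul X s => exact P.tmul_mem_oneForms 𝒜 X s (by simp)
  | add x y hx hy => rw [map_add]; exact add_mem hx hy

theorem ext₁_κ_mem (δ : P.der ⊗[K] 𝔪 𝒜) : ext₁ 𝒜 P.κ δ ∈ P.oneForms 𝒜 1 := by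
  induction δ using TensorProduct.induction_on with
  | zero => rw [map_zero]; exact zero_mem _
  | tmul δ s => exact P.tmul_mem_oneForms 𝒜 (P.kappa δ) s (by simp)
  | add x y hx hy => rw [map_add]; exact add_mem hx hy

theorem ext₂_μ₁_mem (δ : P.der ⊗[K] 𝔪 𝒜) {m : ℕ} {x : P.Forms ⊗[K] 𝔪 𝒜}
    (hx : x ∈ P.oneForms 𝒜 m) : ext₂ 𝒜 P.μ₁ δ x ∈ P.oneForms 𝒜 (m + 1) := by
  induction δ using TensorProduct.induction_on with
  | zero => rw [map_zero]; exact zero_mem _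
  | add x y hx hy => rw [map_add]; exact add_mem hx hy
  | tmul δ s =>
    induction hx using Submodule.span_induction with
    | zero => rw [map_zero]; exact zero_mem _
    | add x y _ _ hx hy => rw [map_add]; exact add_mem hx hy
    | smul c x _ hx => rw [map_smul]; exact Submodule.smul_mem _ _ hx
    | mem x hx =>
      obtain ⟨X, t, ht, rfl⟩ := hx
      rw [ext₂_tmul, μ₁_lof]
      refine P.tmul_mem_oneForms 𝒜 _ _ ?_
      rw [coe_mul₂, mul_comm, pow_succ]
      exact Ideal.mul_mem_mul ht s.2

theorem ext₃_μ₂_mem (δ : P.der ⊗[K] 𝔪 𝒜) {m n : ℕ} {x y : P.Forms ⊗[K] 𝔪 𝒜}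
    (hx : x ∈ P.oneForms 𝒜 m) (hy : y ∈ P.oneForms 𝒜 n) :
    ext₃ 𝒜 P.μ₂ δ x y ∈ P.oneForms 𝒜 (m + n + 1) := by
  induction δ using TensorProduct.induction_on with
  | zero => rw [map_zero]; exact zero_mem _
  | add x y hx hy => rw [map_add]; exact add_mem hx hy
  | tmul δ s =>
    induction hx using Submodule.span_induction with
    | zero => rw [map_zero]; exact zero_mem _
    | add x y _ _ hx hy => rw [map_add]; exact add_mem hx hy
    | smul c x _ hx => rw [map_smul]; exact Submodule.smul_mem _ _ hx
    | mem x hx =>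
      obtain ⟨X, t, ht, rfl⟩ := hx
      induction hy using Submodule.span_induction with
      | zero => rw [map_zero]; exact zero_mem _
      | add x y _ _ hx hy => rw [map_add]; exact add_mem hx hy
      | smul c x _ hx => rw [map_smul]; exact Submodule.smul_mem _ _ hx
      | mem y hy =>
        obtain ⟨Y, u, hu, rfl⟩ := hy
        obtain ⟨Z, hZ⟩ := P.μ₂_lof_one δ X Y
        rw [ext₃_tmul, hZ]
        refine P.tmul_mem_oneForms 𝒜 _ _ ?_
        rw [coe_mul₃, mul_assoc, mul_comm, pow_succ, pow_add]
        exact Ideal.mul_mem_mul (Ideal.mul_mem_mul ht hu) s.2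

/-- Filtration levels add up because coefficients multiply, and the extra `1` is the coefficient of
`δ`. -/
theorem actions_mem (δ : P.der ⊗[K] 𝔪 𝒜) {x : List (P.Forms ⊗[K] 𝔪 𝒜)} {m : List ℕ}
    (h : List.Forall₂ (fun x m => x ∈ P.oneForms 𝒜 m) x m) :
    P.actions 𝒜 δ x ∈ P.oneForms 𝒜 (m.sum + 1) := by
  match x, m, h with
  | [], [], _ => exact P.ext₁_κ_mem 𝒜 δ
  | [x], [m], .cons hx _ => exact P.ext₂_μ₁_mem 𝒜 δ hx
  | [x, y], [m, n], .cons hx (.cons hy _) => exact P.ext₃_μ₂_mem 𝒜 δ hx hy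
  | _ :: _ :: _ :: _, _, _ => exact zero_mem _

/-! ### Moving `b` to the front of a bracket, with coefficients. -/

theorem ext₂_br₂_ofB_right [CharZero K] (b : P.B ⊗[K] 𝔪 𝒜) {x : P.Forms ⊗[K] 𝔪 𝒜}
    (hx : x ∈ P.oneForms 𝒜 0) : ext₂ 𝒜 P.br₂ x (P.ofBCoeff 𝒜 b) =
      (-1 : K) • ext₂ 𝒜 P.br₂ (P.ofBCoeff 𝒜 b) x := by
  induction b using TensorProduct.induction_on with
  | zero => simp only [map_zero, LinearMap.zero_apply, smul_zero]
  | add x y hx hy => simp only [map_add, LinearMap.add_apply, smul_add, hx, hy]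
  | tmul b s =>
    induction hx using Submodule.span_induction with
    | zero => simp only [map_zero, LinearMap.zero_apply, smul_zero]
    | add x y _ _ hx hy => simp only [map_add, LinearMap.add_apply, smul_add, hx, hy]
    | smul c x _ hx =>
      simp only [map_smul, LinearMap.smul_apply, hx]
      exact smul_comm _ _ _
    | mem x hx =>
      obtain ⟨X, t, ht, rfl⟩ := hx
      change ext₂ 𝒜 P.br₂ _ (P.ofB b ⊗ₜ s) = _ • ext₂ 𝒜 P.br₂ (P.ofB b ⊗ₜ s) _
      rw [ext₂_tmul, ext₂_tmul, br₂_ofB_right, TensorProduct.smul_tmul']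
      congr 1
      exact Subtype.ext (by rw [coe_mul₂, coe_mul₂, mul_comm])

theorem ext₃_br₃_ofB_middle (b : P.B ⊗[K] 𝔪 𝒜) {x y : P.Forms ⊗[K] 𝔪 𝒜}
    (hx : x ∈ P.oneForms 𝒜 0) (hy : y ∈ P.oneForms 𝒜 0) :
    ext₃ 𝒜 P.br₃ x (P.ofBCoeff 𝒜 b) y = (-1 : K) • ext₃ 𝒜 P.br₃ (P.ofBCoeff 𝒜 b) x y := by
  induction b using TensorProduct.induction_on with
  | zero => simp only [map_zero, LinearMap.zero_apply, smul_zero]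
  | add x y hx hy => simp only [map_add, LinearMap.add_apply, smul_add, hx, hy]
  | tmul b s =>
    induction hx using Submodule.span_induction with
    | zero => simp only [map_zero, LinearMap.zero_apply, smul_zero]
    | add x y _ _ hx hy => simp only [map_add, LinearMap.add_apply, smul_add, hx, hy]
    | smul c x _ hx =>
      simp only [map_smul, LinearMap.smul_apply, hx]
      exact smul_comm _ _ _
    | mem x hx =>
      obtain ⟨X, t, ht, rfl⟩ := hx
      induction hy using Submodule.span_induction with
      | zero => simp only [map_zero, smul_zero]
      | add x y _ _ hx hy => simp only [map_add, smul_add, hx, hy]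
      | smul c x _ hx =>
        simp only [map_smul, hx]
        exact smul_comm _ _ _
      | mem y hy =>
        obtain ⟨Y, u, hu, rfl⟩ := hy
        change ext₃ 𝒜 P.br₃ _ (P.ofB b ⊗ₜ s) _ = _ • ext₃ 𝒜 P.br₃ (P.ofB b ⊗ₜ s) _ _
        rw [ext₃_tmul, ext₃_tmul, br₃_ofB_middle, TensorProduct.smul_tmul']
        congr 1
        exact Subtype.ext (by rw [coe_mul₃, coe_mul₃]; ring)

theorem ext₃_br₃_ofB_right (b : P.B ⊗[K] 𝔪 𝒜) {x y : P.Forms ⊗[K] 𝔪 𝒜}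
    (hx : x ∈ P.oneForms 𝒜 0) (hy : y ∈ P.oneForms 𝒜 0) :
    ext₃ 𝒜 P.br₃ x y (P.ofBCoeff 𝒜 b) = ext₃ 𝒜 P.br₃ (P.ofBCoeff 𝒜 b) x y := by
  induction b using TensorProduct.induction_on with
  | zero => simp only [map_zero, LinearMap.zero_apply]
  | add x y hx hy => simp only [map_add, LinearMap.add_apply, hx, hy]
  | tmul b s =>
    induction hx using Submodule.span_induction with
    | zero => simp only [map_zero, LinearMap.zero_apply]
    | add x y _ _ hx hy => simp only [map_add, LinearMap.add_apply, hx, hy]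
    | smul c x _ hx => simp only [map_smul, LinearMap.smul_apply, hx]
    | mem x hx =>
      obtain ⟨X, t, ht, rfl⟩ := hx
      induction hy using Submodule.span_induction with
      | zero => simp only [map_zero, LinearMap.zero_apply]
      | add x y _ _ hx hy => simp only [map_add, LinearMap.add_apply, hx, hy]
      | smul c x _ hx => simp only [map_smul, LinearMap.smul_apply, hx]
      | mem y hy =>
        obtain ⟨Y, u, hu, rfl⟩ := hy
        change ext₃ 𝒜 P.br₃ _ _ (P.ofB b ⊗ₜ s) = ext₃ 𝒜 P.br₃ (P.ofB b ⊗ₜ s) _ _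
        rw [ext₃_tmul, ext₃_tmul, br₃_ofB_right]
        congr 1
        exact Subtype.ext (by rw [coe_mul₃, coe_mul₃]; ring)

theorem brackets_eq_zero [CharZero K] {x : List (P.Forms ⊗[K] 𝔪 𝒜)} (hx : 3 < x.length) :
    P.brackets 𝒜 x = 0 := by
  match x, hx with
  | _ :: _ :: _ :: _ :: _, _ => rfl

theorem actions_eq_zero (δ : P.der ⊗[K] 𝔪 𝒜) {x : List (P.Forms ⊗[K] 𝔪 𝒜)}
    (hx : 2 < x.length) : P.actions 𝒜 δ x = 0 := by
  match x, hx with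
  | _ :: _ :: _ :: _, _ => rfl

/-- Moving an element of `B` to the first argument of a bracket, past elements of degree `1`. -/
theorem brackets_append_cons [CharZero K] (b : P.B ⊗[K] 𝔪 𝒜) (x y : List (P.Forms ⊗[K] 𝔪 𝒜))
    (hx : ∀ z ∈ x, z ∈ P.oneForms 𝒜 0) (hy : ∀ z ∈ y, z ∈ P.oneForms 𝒜 0) :
    P.brackets 𝒜 (x ++ P.ofBCoeff 𝒜 b :: y) =
      (-1 : K) ^ x.length • P.actions 𝒜 (ext₁ 𝒜 P.adDer b) (x ++ y) := by
  -- Besides `b`, a nonzero bracket has at most two entries, and so has a nonzero action. This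
  -- leaves six positions of `b` to check.
  by_cases hl : 2 < (x ++ y).length
  · rw [P.actions_eq_zero 𝒜 _ hl, smul_zero, brackets_eq_zero]
    simp only [List.length_append, List.length_cons] at hl ⊢
    omega
  · match x, y with
    | [], [] =>
      simp only [List.length_nil, pow_zero, one_smul]
      exact (P.ext₁_κ_adDer 𝒜 b).symm
    | [], [z] =>
      simp only [List.length_nil, pow_zero, one_smul]
      exact (LinearMap.congr_fun (P.ext₂_μ₁_adDer 𝒜 b) z).symm
    | [], [z, w] =>
      simp only [List.length_nil, pow_zero, one_smul]
      exact (LinearMap.congr_fun₂ (P.ext₃_μ₂_adDer 𝒜 b) z w).symm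
    | [z], [] =>
      refine (P.ext₂_br₂_ofB_right 𝒜 b (hx z (by simp))).trans ?_
      rw [← ext₂_μ₁_adDer]
      simp only [List.length_singleton, pow_one]
      rfl
    | [z], [w] =>
      refine (P.ext₃_br₃_ofB_middle 𝒜 b (hx z (by simp)) (hy w (by simp))).trans ?_
      rw [← ext₃_μ₂_adDer]
      simp only [List.length_singleton, pow_one]
      rfl
    | [z, w], [] =>
      refine (P.ext₃_br₃_ofB_right 𝒜 b (hx z (by simp)) (hx w (by simp))).trans ?_
      rw [← ext₃_μ₂_adDer]
      simp only [List.length_cons, List.length_nil, zero_add, Nat.reduceAdd, even_two,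
        Even.neg_pow, one_pow, one_smul]
      rfl
    | _ :: _ :: _, _ :: _ => simp at hl
    | _ :: _ :: _ :: _, [] => simp at hl
    | [_], _ :: _ :: _ => simp at hl
    | [], _ :: _ :: _ :: _ => simp at hl

/-! ### Comparison and finiteness of the two gauge recursions. -/

/-- The sign `(-1)^j` in the action is the cost of moving `b` past `j` copies of `ξ`. The two series
agree term by term. -/
theorem twist_ofBCoeff [CharZero K] (b : P.B ⊗[K] 𝔪 𝒜) {ξ : P.Forms ⊗[K] 𝔪 𝒜}
    (hξ : ξ ∈ P.oneForms 𝒜 0) (x : List (P.Forms ⊗[K] 𝔪 𝒜)) (hx : ∀ z ∈ x, z ∈ P.oneForms 𝒜 0) :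
    twist K (P.brackets 𝒜) ξ (P.ofBCoeff 𝒜 b :: x) =
      actTwist K (P.actions 𝒜 (ext₁ 𝒜 P.adDer b)) ξ x := by
  refine finsum_congr fun j => ?_
  rw [P.brackets_append_cons 𝒜 b _ _ (fun z hz => ?_) hx, smul_smul, List.length_replicate,
    div_eq_inv_mul]
  rw [List.eq_of_mem_replicate hz]
  exact hξ

theorem actTwist_mem (δ : P.der ⊗[K] 𝔪 𝒜) {ξ : P.Forms ⊗[K] 𝔪 𝒜} (hξ : ξ ∈ P.oneForms 𝒜 0)
    {x : List (P.Forms ⊗[K] 𝔪 𝒜)} {m : List ℕ}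
    (h : List.Forall₂ (fun x m => x ∈ P.oneForms 𝒜 m) x m) :
    actTwist K (P.actions 𝒜 δ) ξ x ∈ P.oneForms 𝒜 (m.sum + 1) := by
  -- The copies of `ξ` are counted at level 0, so they do not change the sum of the levels.
  refine finsum_induction (· ∈ P.oneForms 𝒜 (m.sum + 1)) (zero_mem _) (fun _ _ => add_mem)
    fun j => Submodule.smul_mem _ _ ?_
  have h' : List.Forall₂ (fun x m => x ∈ P.oneForms 𝒜 m) (List.replicate j ξ ++ x)
      (List.replicate j 0 ++ m) := by
    induction j with
    | zero => exact h
    | succ j ih => exact .cons hξ ih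
  simpa using P.actions_mem 𝒜 δ h'

/-- The parts of a composition of `k` contribute levels adding up to `k`, and the derivation adds
one, which is the level required of the term of index `k + 1`. -/
theorem actGaugeTerm_mem (δ : P.der ⊗[K] 𝔪 𝒜) {ξ : P.Forms ⊗[K] 𝔪 𝒜}
    (hξ : ξ ∈ P.oneForms 𝒜 0) (k : ℕ) :
    actGaugeTerm K (P.actions 𝒜 δ) ξ k ∈ P.oneForms 𝒜 k := by
  induction k using Nat.strong_induction_on with
  | _ k ih =>
  match k with
  | 0 => rw [actGaugeTerm]; exact zero_mem _
  | 1 =>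
    rw [actGaugeTerm]
    simpa only [List.sum_nil, zero_add] using P.actTwist_mem 𝒜 δ hξ (x := []) (m := []) .nil
  | k + 2 =>
    rw [actGaugeTerm]
    refine sum_mem fun c _ => Submodule.smul_mem _ _ ?_
    have h := P.actTwist_mem 𝒜 δ hξ (m := List.ofFn c.blocksFun)
      (x := List.ofFn fun i => actGaugeTerm K (P.actions 𝒜 δ) ξ (c.blocksFun i)) (by
        rw [List.forall₂_iff_get]
        refine ⟨by simp, fun i h₁ h₂ => ?_⟩
        simp only [List.get_eq_getElem, List.getElem_ofFn]
        exact ih _ (Nat.lt_succ_of_le (c.blocksFun_le _)))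
    rwa [List.sum_ofFn, c.sum_blocksFun] at h

theorem gaugeTerm_ofBCoeff [CharZero K] (b : P.B ⊗[K] 𝔪 𝒜) {ξ : P.Forms ⊗[K] 𝔪 𝒜}
    (hξ : ξ ∈ P.oneForms 𝒜 0) (k : ℕ) :
    gaugeTerm K (P.brackets 𝒜) ξ (P.ofBCoeff 𝒜 b) k =
      actGaugeTerm K (P.actions 𝒜 (ext₁ 𝒜 P.adDer b)) ξ k := by
  induction k using Nat.strong_induction_on with
  | _ k ih =>
  match k with
  | 0 => rw [actGaugeTerm, gaugeTerm]
  | 1 => rw [actGaugeTerm, gaugeTerm]; exact P.twist_ofBCoeff 𝒜 b hξ [] (by simp)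
  | k + 2 =>
    rw [actGaugeTerm, gaugeTerm]
    refine Finset.sum_congr rfl fun c _ => ?_
    have h : ∀ i, gaugeTerm K (P.brackets 𝒜) ξ (P.ofBCoeff 𝒜 b) (c.blocksFun i) =
        actGaugeTerm K (P.actions 𝒜 (ext₁ 𝒜 P.adDer b)) ξ (c.blocksFun i) := fun i =>
      ih _ (Nat.lt_succ_of_le (c.blocksFun_le i))
    simp only [h]
    rw [P.twist_ofBCoeff 𝒜 b hξ]
    intro z hz
    obtain ⟨i, rfl⟩ := (List.mem_ofFn' _ _).1 hz
    -- Here only the degree of the earlier terms matters: they must have degree 1 for the sign rule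
    -- to apply.
    exact P.oneForms_antitone 𝒜 (Nat.zero_le _) (P.actGaugeTerm_mem 𝒜 _ hξ _)

theorem finite_actGaugeTerm_ne_zero [IsArtinianRing 𝒜] (δ : P.der ⊗[K] 𝔪 𝒜)
    {ξ : P.Forms ⊗[K] 𝔪 𝒜} (hξ : ξ ∈ P.oneForms 𝒜 0) :
    {k | actGaugeTerm K (P.actions 𝒜 δ) ξ k ≠ 0}.Finite := by
  -- In a local ring the Jacobson radical is the maximal ideal, so `𝔪^N = 0` and the terms of index
  -- at least `N` vanish.
  obtain ⟨N, hN⟩ := IsArtinianRing.isNilpotent_jacobson_bot (R := 𝒜)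
  rw [IsLocalRing.jacobson_eq_maximalIdeal _ bot_ne_top] at hN
  refine (Set.finite_lt_nat N).subset fun k hk => ?_
  by_contra hkN
  refine hk ?_
  have h := P.oneForms_antitone 𝒜 (not_lt.1 hkN) (P.actGaugeTerm_mem 𝒜 δ hξ k)
  rwa [P.oneForms_eq_bot 𝒜 hN, Submodule.mem_bot] at h

theorem actGaugeAction_adDer [CharZero K] (b : P.B ⊗[K] 𝔪 𝒜) {ξ : P.Forms ⊗[K] 𝔪 𝒜}
    (hξ : ξ ∈ P.oneForms 𝒜 0) :
    actGaugeAction K (P.actions 𝒜 (ext₁ 𝒜 P.adDer b)) ξ =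
      gaugeAction K (P.brackets 𝒜) (P.ofBCoeff 𝒜 b) ξ := by
  simp only [actGaugeAction, gaugeAction, P.gaugeTerm_ofBCoeff 𝒜 b hξ]

end Coefficients

end SplitLiePair

theorem theorem5p3 {𝕂 : Type*} [RCLike 𝕂] {n : ℕ}
    -- the base, a smooth manifold
    {M : Type*} [TopologicalSpace M] [ChartedSpace (EuclideanSpace ℝ (Fin n)) M]
    [IsManifold (𝓡 n) ∞ M] [T2Space M] [SecondCountableTopology M]
    -- a smooth vector bundle of finite rank over the field of real or complex numbers
    {F : Type*} [NormedAddCommGroup F] [NormedSpace ℝ F] [NormedSpace 𝕂 F] [IsScalarTower ℝ 𝕂 F]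
    [FiniteDimensional 𝕂 F]
    {E : M → Type*} [∀ x, AddCommGroup (E x)] [∀ x, Module ℝ (E x)] [∀ x, Module 𝕂 (E x)]
    [∀ x, IsScalarTower ℝ 𝕂 (E x)] [∀ x, TopologicalSpace (E x)]
    [TopologicalSpace (Bundle.TotalSpace F E)] [FiberBundle F E] [VectorBundle ℝ F E]
    [VectorBundle 𝕂 F E] [ContMDiffVectorBundle ∞ F E (𝓡 n)]
    -- a Lie algebroid structure on it, with a Lie subalgebroid and a complement
    (S : SplitLieAlgebroid 𝕂 n F E)
    -- a local Artinian algebra with residue field `𝕂`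
    {𝒜 : Type*} [CommRing 𝒜] [Algebra 𝕂 𝒜] [IsLocalRing 𝒜] [IsArtinianRing 𝒜]
    (h𝒜 : Function.Bijective (algebraMap 𝕂 (IsLocalRing.ResidueField 𝒜)))
    (b : ↥S.toSplitLiePair.B ⊗[𝕂] SplitLiePair.𝔪 𝒜) :
    let P := S.toSplitLiePair
    -- the operator `ad_b` is given by a unique element of `Der(L) ⊗ 𝔪`
    (∃! δ : ↥P.der ⊗[𝕂] SplitLiePair.𝔪 𝒜, P.derOp 𝒜 δ = P.adOp 𝒜 b) ∧
    ∀ δ : ↥P.der ⊗[𝕂] SplitLiePair.𝔪 𝒜, P.derOp 𝒜 δ = P.adOp 𝒜 b →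
      -- its actions are the brackets with `b`
      SplitLiePair.ext₁ 𝒜 P.κ δ = SplitLiePair.ext₁ 𝒜 P.d (P.ofBCoeff 𝒜 b) ∧
      (∀ X, SplitLiePair.ext₂ 𝒜 P.μ₁ δ X = SplitLiePair.ext₂ 𝒜 P.br₂ (P.ofBCoeff 𝒜 b) X) ∧
      (∀ X Y, SplitLiePair.ext₃ 𝒜 P.μ₂ δ X Y = SplitLiePair.ext₃ 𝒜 P.br₃ (P.ofBCoeff 𝒜 b) X Y) ∧
      -- the two gauge actions are given by finite sums, and they coincide
      ∀ ξ ∈ P.MC 𝒜,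
        {k | SplitLiePair.actGaugeTerm 𝕂 (P.actions 𝒜 δ) ξ k ≠ 0}.Finite ∧
        {k | SplitLiePair.gaugeTerm 𝕂 (P.brackets 𝒜) ξ (P.ofBCoeff 𝒜 b) k ≠ 0}.Finite ∧
        SplitLiePair.actGaugeAction 𝕂 (P.actions 𝒜 δ) ξ =
          SplitLiePair.gaugeAction 𝕂 (P.brackets 𝒜) (P.ofBCoeff 𝒜 b) ξ := by
  intro P
  refine ⟨P.existsUnique_derOp_eq_adOp 𝒜 b, fun δ hδ => ?_⟩
  -- By uniqueness, any element that induces `ad_b` is the extension of the inner derivations, for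
  -- which the identities are known.
  obtain rfl : δ = SplitLiePair.ext₁ 𝒜 P.adDer b :=
    P.derOp_injective 𝒜 (hδ.trans (P.derOp_adDer 𝒜 b).symm)
  refine ⟨P.ext₁_κ_adDer 𝒜 b, fun X => LinearMap.congr_fun (P.ext₂_μ₁_adDer 𝒜 b) X,
    fun X Y => LinearMap.congr_fun₂ (P.ext₃_μ₂_adDer 𝒜 b) X Y, fun ξ hξ => ?_⟩
  have h := P.range_ext₁_lof_le 𝒜 hξ.1
  refine ⟨P.finite_actGaugeTerm_ne_zero 𝒜 _ h, ?_, P.actGaugeAction_adDer 𝒜 b h⟩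
  simp only [P.gaugeTerm_ofBCoeff 𝒜 b h]
  exact P.finite_actGaugeTerm_ne_zero 𝒜 _ h
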